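/- Let $\mathbb F\in\{\mathbb R,\mathbb C\}$, let $M$ be a Hausdorff smooth manifold (of dimension $n$), let $R=\mathcal C_c^\infty(M)$ be the ring (in general without identity) of smooth $\mathbb F$-valued functions with compact support on $M$, and let $(\mathcal C^\infty_M)_x$ be the ring of germs at $x\in M$ of smooth $\mathbb F$-valued functions; $f_x$ denotes the germ of $f$ at $x$. A coalgebra over $R$ is an $R$-module $C$ that is locally unitary (for any $c_1,\dots,c_k\in C$ there is $r\in R$ with $rc_i=c_i$ for all $i$), with $R$-linear maps $\Delta:C\to C\otimes_R C$ and $\epsilon:C\to R$ satisfying $(\mathrm{id}\otimes\epsilon)\Delta=\mathrm{id}=(\epsilon\otimes\mathrm{id})\Delta$. A homomorphism of coalgebras is an $R$-linear map $\alpha$ with $(\alpha\otimes\alpha)\Delta=\Delta\alpha$ and $\epsilon\alpha=\epsilon$. A sheaf on $M$ is a smooth manifold $E$, not necessarily Hausdorff, with a local diffeomorphism $\pi:E\to M$; isomorphisms of sheaves are diffeomorphisms over $M$. $\mathcal C_c^\infty(E)$ is the space of all finite sums, inside the not necessarily continuous sections of the sheaf of germs of smooth functions on $E$, of extensions by zero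 of smooth functions with compact support defined on Hausdorff open subsets of $E$. It is an $R$-module through $\pi$. The map $\Omega:\mathcal C_c^\infty(E)\otimes_R\mathcal C_c^\infty(E)\to\mathcal C_c^\infty(E\times_M E)$ which sends $u\otimes v$ to the section whose germ at $(y,z)$ is $(u_y\circ \mathrm{pr}_1)(v_z\circ \mathrm{pr}_2)$ is injective. $\mathcal C_c^\infty(E)$ is a coalgebra over $R$ with $\Delta=\Omega^{-1}\circ\mathrm{diag}_+$ and $\epsilon=\pi_+$, where $\mathrm{diag}_+$ is the extension by zero along the diagonal $E\to E\times_M E$ and $\pi_+(u)(x)=\sum_{\pi(y)=x}u_y(y)$. Let $C$ be a coalgebra over $R$. For $x\in M$ put $N_x(C)=\{c\in C: fc=0\text{ for some }f\in R\text{ with }f_x=1\}$ and $C_x=C/N_x(C)$, a coalgebra over $(\mathcal C^\infty_M)_x$ with the induced $\Delta_x,\epsilon_x$; let $c_x$ be the class of $c\in C$. The set of grouplike elements of $C_x$ is $G(C_x)=\{\zeta\in C_x:\Delta_x(\zeta)=\zeta\otimes\zeta,\ \epsilon_x(\zeta)=1\}$. An element $c\in C$ is weakly grouplike if $\Delta(c)=c\otimes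 c'$ for some $c'\in C$; it is normalized at $x$ if $\epsilon(c)_x=1$, and normalized on $W\subset M$ if it is normalized at every point of $W$. The spectral sheaf $\mathcal E_{sp}(C)$ of $C$ is the sheaf on $M$ with stalk $G(C_x)$ at $x$, topologized by the basis of the sets $c_W=\{c_x: x\in W\}$, where $W\subset M$ is open and $c$ is weakly grouplike and normalized on $W$; its smooth structure is the one for which the projection $\pi_{sp}$ to $M$ is a local diffeomorphism. The homomorphism of coalgebras $\Psi_C:\mathcal C_c^\infty(\mathcal E_{sp}(C))\to C$ is determined by $\Psi_C(f\circ\pi_{sp}|_{c_W})=fc$ for all such $c,W$ and all $f\in\mathcal C_c^\infty(W)$. A subset $\Lambda\subset C$ normally generates $C$ if every $c\in C$ is a finite sum $\sum_i f_ic_i$ with $f_i\in R$ and $c_i\in\Lambda$ normalized on $\mathrm{supp}(f_i)$. It is normally linearly independent if for every $x\in M$, all $c_1,\dots,c_k\in\Lambda$ normalized at $x$ and all $f_1,\dots,f_k\in R$ with $\sum_i f_ic_i=0$, either $(f_i)_x=0$ for all $i$, or there are $i\ne j$ and $f\in R$ with $f_x=1$ and $fc_i=fc_j$. Then the following conditions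 on $C$ are equivalent: (i) $C$ is isomorphic, as a coalgebra over $R$, to $\mathcal C_c^\infty(E)$ for some sheaf $E$ on $M$. (ii) $\Psi_C:\mathcal C_c^\infty(\mathcal E_{sp}(C))\to C$ is an isomorphism. (iii) The weakly grouplike elements of $C$ normally generate $C$ and are normally linearly independent. (iv) For every $x\in M$ the $(\mathcal C^\infty_M)_x$-module $C_x$ is freely generated by $G(C_x)$. Moreover, if $C$ is isomorphic to $\mathcal C_c^\infty(E)$ for a sheaf $E$ on $M$, then $E$ is isomorphic, as a sheaf on $M$, to $\mathcal E_{sp}(C)$. -/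

import Mathlib

open scoped Manifold ContDiff Topology TensorProduct
open Filter

universe u v w w₂

namespace SheafCoalg
noncomputable section

/-- The unital ring `ℤ ⊕ R` obtained from the (possibly non-unital) commutative ring `R` by adjoining
an identity. A module over the non-unital ring `R` is the same thing as a unital module over `Plus R`,
an additive map between such modules is `R`-linear if and only if it is `Plus R`-linear, and
the tensor product over `R` is the tensor product over `Plus R`. -/
def Plus (R : Type*) [NonUnitalCommRing R] := Unitization ℤ R

instance (R : Type*) [NonUnitalCommRing R] : CommRing (Plus R) :=
  inferInstanceAs (CommRing (Unitization ℤ R))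

namespace Plus
variable {R : Type*} [NonUnitalCommRing R]

/-- The element `r` of `R`, as an element of `ℤ ⊕ R`. -/
def of (r : R) : Plus R := (Unitization.inr r : Unitization ℤ R)
/-- The component in `ℤ` of an element of `ℤ ⊕ R`. -/
def int (a : Plus R) : ℤ := (show Unitization ℤ R from a).toProd.1
/-- The component in `R` of an element of `ℤ ⊕ R`. -/
def part (a : Plus R) : R := (show Unitization ℤ R from a).toProd.2

theorem of_add (r s : R) : of (r + s) = of r + of s := Unitization.inr_add ℤ r s
theorem of_sub (r s : R) : of (r - s) = of r - of s := Unitization.inr_sub ℤ r s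
theorem of_zero : of (0 : R) = 0 := Unitization.inr_zero ℤ
theorem of_mul (r s : R) : of (r * s) = of r * of s := Unitization.inr_mul ℤ r s
theorem eq_int_add_of (a : Plus R) : a = (a.int : Plus R) + of a.part := by
  have := (Unitization.inl_fst_add_inr_snd_eq (R := ℤ) (A := R) a).symm
  refine this.trans ?_
  have h : ((Unitization.inl a.toProd.1 : Unitization ℤ R) : Plus R) = ((a.int : ℤ) : Plus R) := by
    have h1 := map_intCast (Unitization.inlRingHom ℤ R) a.int
    rw [Int.cast_id] at h1
    exact h1
  exact congrArg (· + of a.part) h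
theorem mul_of (a : Plus R) (r : R) : a * of r = of (a.int • r + a.part * r) := by
  conv_lhs => rw [eq_int_add_of a]
  rw [add_mul, ← of_mul, of_add]
  congr 1
  change _ = (Unitization.inr (a.int • r) : Unitization ℤ R)
  rw [Unitization.inr_smul, zsmul_eq_mul]
  rfl
/-- The unital extension of a homomorphism from `R` to a unital ring. -/
def lift {S : Type*} [CommRing S] (g : R →ₙ+* S) : Plus R →+* S where
  toFun a := (a.int : S) + g a.part
  map_one' := by
    change ((1 : ℤ) : S) + g 0 = 1
    simp
  map_zero' := by
    change ((0 : ℤ) : S) + g 0 = 0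
    simp
  map_add' a b := by
    change ((a.int + b.int : ℤ) : S) + g (a.part + b.part) = _
    push_cast
    rw [map_add]; ring
  map_mul' a b := by
    change ((a.int * b.int : ℤ) : S) + g (a.int • b.part + b.int • a.part + a.part * b.part) = _
    push_cast
    rw [map_add, map_add, map_mul, map_zsmul, map_zsmul, zsmul_eq_mul, zsmul_eq_mul]; ring
theorem lift_of {S : Type*} [CommRing S] (g : R →ₙ+* S) (r : R) : lift g (of r) = g r := by
  change ((0 : ℤ) : S) + g r = g r
  simp
theorem lift_apply {S : Type*} [CommRing S] (g : R →ₙ+* S) (a : Plus R) :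
    lift g a = (a.int : S) + g a.part := rfl
theorem int_of (r : R) : (of r).int = 0 := rfl
theorem part_of (r : R) : (of r).part = r := rfl

end Plus

section Alg
variable {R : Type*} [NonUnitalCommRing R]

/-- The ring `R` as a module over itself. -/
instance selfModule : Module (Plus R) R where
  smul a r := a.int • r + a.part * r
  one_smul r := by change (1:ℤ) • r + 0 * r = r; simp
  mul_smul a b r := by
    change (a.int * b.int) • r + (a.int • b.part + b.int • a.part + a.part * b.part) * r
      = a.int • (b.int • r + b.part * r) + a.part * (b.int • r + b.part * r)
    simp only [add_mul, smul_add, mul_add, mul_smul,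
      smul_mul_assoc, mul_smul_comm, mul_assoc]
    abel
  smul_zero a := by change a.int • (0:R) + a.part * 0 = 0; simp
  smul_add a r s := by
    change a.int • (r + s) + a.part * (r + s) = (a.int • r + a.part * r) + (a.int • s + a.part * s)
    simp only [smul_add, mul_add]; abel
  add_smul a b r := by
    change (a.int + b.int) • r + (a.part + b.part) * r = (a.int • r + a.part * r) + (b.int • r + b.part * r)
    simp only [add_smul, add_mul]; abel
  zero_smul r := by change (0:ℤ) • r + 0 * r = 0; simp

/-- The action `r ⋆ c` of `r : R` on an element `c` of an `R`-module. -/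
notation:73 r:74 " ⋆ " c:73 => Plus.of r • c

variable {C : Type*} [AddCommGroup C] [Module (Plus R) C]

theorem smul_def (a : Plus R) (r : R) : a • r = a.int • r + a.part * r := rfl
theorem star_self (r s : R) : r ⋆ s = r * s := by simp [smul_def, Plus.int_of, Plus.part_of]
theorem star_star (r s : R) (c : C) : r ⋆ s ⋆ c = (r * s) ⋆ c := by
  rw [Plus.of_mul, mul_smul]

/-- The bilinear map `(c, r) ↦ r ⋆ c`; it induces the identifications of `C ⊗ R` and `R ⊗ C` with `C`. -/
def act : C →ₗ[Plus R] R →ₗ[Plus R] C :=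
  LinearMap.mk₂ (Plus R) (fun c r => r ⋆ c)
    (fun c d r => smul_add _ c d)
    (fun a c r => smul_comm _ a c)
    (fun c r s => by rw [Plus.of_add, add_smul])
    (fun a c r => by
      change Plus.of (a • r) • c = _
      rw [smul_def, ← Plus.mul_of, mul_smul])

theorem act_apply (c : C) (r : R) : act c r = r ⋆ c := rfl

/-- The `R`-module `C` is locally unitary. -/
def LocallyUnitary (R : Type*) [NonUnitalCommRing R] (C : Type*) [AddCommGroup C] [Module (Plus R) C] : Prop :=
  ∀ s : Finset C, ∃ r : R, ∀ c ∈ s, r ⋆ c = c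

theorem locallyUnitary_of_forall (h : ∀ c : C, ∃ r : R, r ⋆ c = c) : LocallyUnitary R C := by
  classical
  intro s
  induction s using Finset.induction_on with
  | empty => exact ⟨0, by simp⟩
  | insert d s _ ih =>
    obtain ⟨r, hr⟩ := ih
    obtain ⟨q, hq⟩ := h d
    have key : ∀ c : C, (r + q - r * q) ⋆ c = r ⋆ c + q ⋆ c - r ⋆ q ⋆ c := fun c => by
      rw [star_star, Plus.of_sub, Plus.of_add, sub_smul, add_smul]
    refine ⟨r + q - r * q, fun c hc => ?_⟩
    rw [key]
    rcases Finset.mem_insert.1 hc with rfl | hc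
    · rw [hq]; abel
    · rw [star_star, mul_comm, ← star_star, hr c hc]; abel

/-- A coalgebra over a commutative ring `R` which need not have an identity: a locally unitary
`R`-module with a comultiplication and a counit satisfying `(id ⊗ ε) ∘ Δ = id = (ε ⊗ id) ∘ Δ`, with
`C ⊗ R` and `R ⊗ C` identified with `C` by the action. Neither coassociativity nor cocommutativity
is assumed. -/
class NUCoalgebra (R : Type*) [NonUnitalCommRing R] (C : Type*) [AddCommGroup C] [Module (Plus R) C] where
  /-- `C` is locally unitary -/
  locallyUnitary : LocallyUnitary R C
  /-- the comultiplication `Δ` -/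
  comul : C →ₗ[Plus R] C ⊗[Plus R] C
  /-- the counit `ε` -/
  counit : C →ₗ[Plus R] R
  id_tensor_counit : ∀ c, TensorProduct.lift act (counit.lTensor C (comul c)) = c
  counit_tensor_id : ∀ c, TensorProduct.lift act.flip (counit.rTensor C (comul c)) = c

end Alg

theorem contMDiffAt_mul {𝔽 : Type*} [RCLike 𝔽] {n : ℕ} {M : Type*} [TopologicalSpace M]
    [ChartedSpace (EuclideanSpace ℝ (Fin n)) M] {f g : M → 𝔽} {x : M}
    (hf : ContMDiffAt (𝓡 n) 𝓘(ℝ, 𝔽) ∞ f x) (hg : ContMDiffAt (𝓡 n) 𝓘(ℝ, 𝔽) ∞ g x) :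
    ContMDiffAt (𝓡 n) 𝓘(ℝ, 𝔽) ∞ (f * g) x :=
  ContMDiffAt.comp (g := fun p : 𝔽 × 𝔽 => p.1 * p.2) x
    ((contDiff_mul (𝕜 := ℝ) (𝔸 := 𝔽)).contMDiff.contMDiffAt (x := (f x, g x))) (hf.prodMk_space hg)

variable (𝔽 : Type) [RCLike 𝔽] (n : ℕ) (M : Type u) [TopologicalSpace M] [ChartedSpace (EuclideanSpace ℝ (Fin n)) M] 

/-- The ring (without identity in general) of smooth `𝔽`-valued functions with compact support on `M`. -/
def Cc : NonUnitalSubalgebra 𝔽 (M → 𝔽) where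
  carrier := {f | ContMDiff (𝓡 n) 𝓘(ℝ, 𝔽) ∞ f ∧ HasCompactSupport f}
  add_mem' := fun hf hg => ⟨hf.1.add hg.1, hf.2.add hg.2⟩
  zero_mem' := ⟨contMDiff_const, HasCompactSupport.zero⟩
  mul_mem' := fun hf hg => ⟨fun x => contMDiffAt_mul (hf.1 x) (hg.1 x), hf.2.mul_right⟩
  smul_mem' := fun c _ hf => ⟨fun x => contMDiffAt_mul (f := fun _ => c) contMDiffAt_const (hf.1 x), hf.2.smul_left (f := fun _ => c)⟩

variable {M}
/-- The ring of germs at `x` of smooth `𝔽`-valued functions. -/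
def germRing (x : M) : Subring ((𝓝 x).Germ 𝔽) where
  carrier := {γ | ∃ f : M → 𝔽, (∀ᶠ y in 𝓝 x, ContMDiffAt (𝓡 n) 𝓘(ℝ, 𝔽) ∞ f y) ∧ γ = (f : (𝓝 x).Germ 𝔽)}
  mul_mem' := by
    rintro _ _ ⟨f, hf, rfl⟩ ⟨g, hg, rfl⟩
    exact ⟨f * g, by filter_upwards [hf, hg] with y h1 h2 using contMDiffAt_mul h1 h2, rfl⟩
  one_mem' := ⟨1, Eventually.of_forall fun y => contMDiffAt_const, rfl⟩
  add_mem' := by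
    rintro _ _ ⟨f, hf, rfl⟩ ⟨g, hg, rfl⟩
    exact ⟨f + g, by filter_upwards [hf, hg] with y h1 h2 using h1.add h2, rfl⟩
  zero_mem' := ⟨0, Eventually.of_forall fun y => contMDiffAt_const, rfl⟩
  neg_mem' := by
    rintro _ ⟨f, hf, rfl⟩
    exact ⟨-f, by filter_upwards [hf] with y h1 using h1.neg, rfl⟩

end
end SheafCoalg

namespace SheafCoalg
noncomputable section

variable {𝔽 : Type} [RCLike 𝔽] {n : ℕ} {M : Type u} [TopologicalSpace M] [ChartedSpace (EuclideanSpace ℝ (Fin n)) M] 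

theorem Cc.mem_of [T2Space M] {h : M → 𝔽} {K W : Set M} (hK : IsCompact K) (hKW : K ⊆ W)
    (hh : ∀ y ∈ W, ContMDiffAt (𝓡 n) 𝓘(ℝ, 𝔽) ∞ h y) (h0 : ∀ y ∉ K, h y = 0) : h ∈ Cc 𝔽 n M := by
  refine ⟨fun y => ?_, HasCompactSupport.intro hK (fun x hx => h0 x hx)⟩
  by_cases hy : y ∈ W
  · exact hh y hy
  · have : h =ᶠ[𝓝 y] fun _ => 0 := by
      filter_upwards [hK.isClosed.isOpen_compl.mem_nhds (fun h => hy (hKW h))] with z hz using h0 z hz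
    exact (contMDiffAt_const (c := (0:𝔽))).congr_of_eventuallyEq this

theorem Cc.exists_bump [T2Space M] [IsManifold (𝓡 n) ∞ M] (x : M) {U : Set M} (hU : U ∈ 𝓝 x) :
    ∃ f : Cc 𝔽 n M, (f : M → 𝔽) =ᶠ[𝓝 x] 1 ∧ tsupport (f : M → 𝔽) ⊆ U := by
  obtain ⟨b, -, hb⟩ := (SmoothBumpFunction.nhds_basis_tsupport (I := 𝓡 n) x).mem_iff.1 hU
  have hs : tsupport (fun y => ((b y : ℝ) : 𝔽)) ⊆ tsupport b := by
    apply closure_mono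
    intro y hy
    simp only [Function.mem_support, ne_eq, RCLike.ofReal_eq_zero] at hy
    exact hy
  refine ⟨⟨fun y => ((b y : ℝ) : 𝔽), ?_, ?_⟩, ?_, hs.trans hb⟩
  · exact (RCLike.ofRealCLM (K := 𝔽)).contDiff.contMDiff.comp b.contMDiff
  · exact b.hasCompactSupport.of_isClosed_subset (isClosed_tsupport _) hs
  · filter_upwards [b.eventuallyEq_one] with y hy
    simp [hy]

theorem Cc.exists_eq_one [T2Space M] [IsManifold (𝓡 n) ∞ M] {K U : Set M} (hK : IsCompact K)
    (hU : IsOpen U) (hKU : K ⊆ U) :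
    ∃ f : Cc 𝔽 n M, (∀ x ∈ K, (f : M → 𝔽) =ᶠ[𝓝 x] 1) ∧ tsupport (f : M → 𝔽) ⊆ U := by
  refine IsCompact.induction_on (p := fun K => ∃ f : Cc 𝔽 n M, (∀ x ∈ K, (f : M → 𝔽) =ᶠ[𝓝 x] 1) ∧
    tsupport (f : M → 𝔽) ⊆ U) hK ⟨0, by simp, by simp [tsupport]⟩
    (fun s t hst ⟨f, hf, h⟩ => ⟨f, fun x hx => hf x (hst hx), h⟩) ?_ ?_
  · rintro s t ⟨f, hf, hf'⟩ ⟨g, hg, hg'⟩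
    refine ⟨f + g - f * g, ?_, ?_⟩
    · rintro x (hx | hx)
      · filter_upwards [hf x hx] with y hy
        have : (f : M → 𝔽) y = 1 := hy
        simp [this]
      · filter_upwards [hg x hx] with y hy
        have : (g : M → 𝔽) y = 1 := hy
        simp [this]
    · have : tsupport ((f + g - f * g : Cc 𝔽 n M) : M → 𝔽) ⊆ tsupport (f : M → 𝔽) ∪ tsupport (g : M → 𝔽) := by
        rw [tsupport, tsupport, tsupport, ← closure_union]
        apply closure_mono
        intro y hy
        by_contra hc
        simp only [Set.mem_union, Function.mem_support, not_or, not_not] at hc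
        apply hy
        simp [hc.1, hc.2]
      exact this.trans (Set.union_subset hf' hg')
  · intro x hx
    obtain ⟨f, hf, h⟩ := Cc.exists_bump (𝔽 := 𝔽) (n := n) x (hU.mem_nhds (hKU hx))
    have h2 := hf.eventuallyEq_nhds
    exact ⟨{y | (f : M → 𝔽) =ᶠ[𝓝 y] 1}, mem_nhdsWithin_of_mem_nhds h2, f, fun y hy => hy, h⟩

/-- The germ `f_x` at `x` of a smooth function `f` with compact support. -/
def Cc.germ (x : M) : Cc 𝔽 n M →ₙ+* germRing 𝔽 n x where
  toFun f := ⟨((f : M → 𝔽) : (𝓝 x).Germ 𝔽), f, Eventually.of_forall f.2.1, rfl⟩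
  map_mul' _ _ := rfl
  map_zero' := rfl
  map_add' _ _ := rfl

theorem Cc.germ_eq_iff {x : M} {f g : Cc 𝔽 n M} :
    Cc.germ x f = Cc.germ x g ↔ (f : M → 𝔽) =ᶠ[𝓝 x] g :=
  Subtype.ext_iff.trans Germ.coe_eq
theorem Cc.germ_eq_one {x : M} {f : Cc 𝔽 n M} :
    Cc.germ x f = 1 ↔ (f : M → 𝔽) =ᶠ[𝓝 x] 1 :=
  Subtype.ext_iff.trans Germ.coe_eq
theorem Cc.germ_eq_zero {x : M} {f : Cc 𝔽 n M} :
    Cc.germ x f = 0 ↔ (f : M → 𝔽) =ᶠ[𝓝 x] 0 :=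
  Subtype.ext_iff.trans Germ.coe_eq

theorem Cc.exists_germ_eq [T2Space M] [IsManifold (𝓡 n) ∞ M] (x : M) (γ : germRing 𝔽 n x) :
    ∃ f : Cc 𝔽 n M, Cc.germ x f = γ := by
  obtain ⟨_, f, hf, rfl⟩ := γ
  obtain ⟨W, hWx, hW⟩ := eventually_nhds_iff.1 hf
  obtain ⟨b, hb, hbs⟩ := Cc.exists_bump (𝔽 := 𝔽) (n := n) x (hW.1.mem_nhds hW.2)
  refine ⟨⟨b * f, Cc.mem_of b.2.2.isCompact hbs
    (fun y hy => contMDiffAt_mul (b.2.1 y) (hWx y hy)) (fun y hy => ?_)⟩, ?_⟩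
  · simp [image_eq_zero_of_notMem_tsupport hy]
  · apply Subtype.ext
    apply Germ.coe_eq.2
    filter_upwards [hb] with y hy
    change (b : M → 𝔽) y * f y = f y
    rw [hy]; simp

/-- The unital extension of `f ↦ f_x`. -/
def toGerm (x : M) : Plus (Cc 𝔽 n M) →+* germRing 𝔽 n x := Plus.lift (Cc.germ x)

theorem toGerm_of (x : M) (f : Cc 𝔽 n M) : toGerm x (Plus.of f) = Cc.germ x f := Plus.lift_of _ _

theorem toGerm_surjective [T2Space M] [IsManifold (𝓡 n) ∞ M] (x : M) :
    Function.Surjective (toGerm (𝔽 := 𝔽) (n := n) x) := fun γ => by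
  obtain ⟨f, rfl⟩ := Cc.exists_germ_eq x γ
  exact ⟨Plus.of f, toGerm_of x f⟩

theorem exists_mul_eq_zero [T2Space M] [IsManifold (𝓡 n) ∞ M] {x : M} {a : Plus (Cc 𝔽 n M)} (h : toGerm x a = 0) :
    ∃ k : Cc 𝔽 n M, Cc.germ x k = 1 ∧ Plus.of k * a = 0 := by
  have h1 : ∀ᶠ y in 𝓝 x, (a.int : 𝔽) + (a.part : M → 𝔽) y = 0 := by
    have h2 := congrArg Subtype.val h
    exact Germ.coe_eq.1 h2
  obtain ⟨k, hk, hks⟩ := Cc.exists_bump (𝔽 := 𝔽) (n := n) x h1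
  refine ⟨k, Cc.germ_eq_one.2 hk, ?_⟩
  rw [mul_comm, Plus.mul_of, ← Plus.of_zero]
  congr 1
  ext y
  change (a.int • (k : M → 𝔽) y) + (a.part : M → 𝔽) y * (k : M → 𝔽) y = 0
  rw [zsmul_eq_mul, ← add_mul]
  by_cases hy : y ∈ tsupport (k : M → 𝔽)
  · rw [hks hy, zero_mul]
  · rw [image_eq_zero_of_notMem_tsupport hy, mul_zero]

theorem exists_mul_eq [T2Space M] [IsManifold (𝓡 n) ∞ M] {x : M} {f : Cc 𝔽 n M} (h : Cc.germ x f = 1) :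
    ∃ k : Cc 𝔽 n M, Cc.germ x k = 1 ∧ k * f = k := by
  obtain ⟨k, hk, hks⟩ := Cc.exists_bump (𝔽 := 𝔽) (n := n) x (Cc.germ_eq_one.1 h)
  refine ⟨k, Cc.germ_eq_one.2 hk, ?_⟩
  ext y
  change (k : M → 𝔽) y * (f : M → 𝔽) y = (k : M → 𝔽) y
  by_cases hy : y ∈ tsupport (k : M → 𝔽)
  · have : (f : M → 𝔽) y = 1 := hks hy
    rw [this, mul_one]
  · rw [image_eq_zero_of_notMem_tsupport hy, zero_mul]

variable [T2Space M] [IsManifold (𝓡 n) ∞ M]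

section Loc
variable (𝔽 n)
variable (C : Type v) [AddCommGroup C] [Module (Plus (Cc 𝔽 n M)) C]

/-- The submodule `N_x(C)` of all `c` such that `f c = 0` for some `f` with `f_x = 1`. -/
def Nx (x : M) : Submodule (Plus (Cc 𝔽 n M)) C where
  carrier := {c | ∃ f : Cc 𝔽 n M, Cc.germ x f = 1 ∧ f ⋆ c = 0}
  add_mem' := by
    rintro c d ⟨f, hf, hfc⟩ ⟨g, hg, hgd⟩
    refine ⟨f * g, by rw [map_mul, hf, hg, mul_one], ?_⟩
    rw [smul_add, ← star_star, ← star_star, hgd, smul_zero, add_zero, star_star, mul_comm, ← star_star, hfc, smul_zero]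
  zero_mem' := by
    obtain ⟨f, hf, -⟩ := Cc.exists_bump (𝔽 := 𝔽) (n := n) x Filter.univ_mem
    exact ⟨f, Cc.germ_eq_one.2 hf, smul_zero _⟩
  smul_mem' := by
    rintro a c ⟨f, hf, hfc⟩
    exact ⟨f, hf, by rw [smul_comm, hfc, smul_zero]⟩

variable {𝔽 n C}
theorem smul_mem_Nx {x : M} {a : Plus (Cc 𝔽 n M)} (h : toGerm x a = 0) (c : C) : a • c ∈ Nx 𝔽 n C x := by
  obtain ⟨k, hk, hka⟩ := exists_mul_eq_zero h
  exact ⟨k, hk, by rw [← mul_smul, hka, zero_smul]⟩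

theorem sub_mem_Nx {x : M} {f : Cc 𝔽 n M} (h : Cc.germ x f = 1) (c : C) : c - f ⋆ c ∈ Nx 𝔽 n C x := by
  have := smul_mem_Nx (x := x) (a := 1 - Plus.of f) (by rw [map_sub, map_one, toGerm_of, h, sub_self]) c
  rwa [sub_smul, one_smul] at this

theorem Nx_map {D : Type*} [AddCommGroup D] [Module (Plus (Cc 𝔽 n M)) D]
    (φ : C →ₗ[Plus (Cc 𝔽 n M)] D) {x : M} {c : C} (hc : c ∈ Nx 𝔽 n C x) : φ c ∈ Nx 𝔽 n D x := by
  obtain ⟨f, hf, h⟩ := hc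
  exact ⟨f, hf, by rw [← map_smul, h, map_zero]⟩

theorem eq_zero_of_forall_mem_Nx (hC : LocallyUnitary (Cc 𝔽 n M) C) {c : C} (hc : ∀ x : M, c ∈ Nx 𝔽 n C x) : c = 0 := by
  obtain ⟨ρ, hρ⟩ := hC {c}
  have hρ := hρ c (Finset.mem_singleton_self c)
  obtain ⟨g, hg, hgc⟩ : ∃ g : Cc 𝔽 n M, (∀ x ∈ tsupport (ρ : M → 𝔽), (g : M → 𝔽) x = 1) ∧ g ⋆ c = 0 := by
    refine IsCompact.induction_on (p := fun K => ∃ g : Cc 𝔽 n M, (∀ x ∈ K, (g : M → 𝔽) x = 1) ∧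
      g ⋆ c = 0) ρ.2.2.isCompact ⟨0, by simp, by rw [Plus.of_zero, zero_smul]⟩
      (fun s t hst ⟨f, hf, h⟩ => ⟨f, fun x hx => hf x (hst hx), h⟩) ?_ ?_
    · rintro s t ⟨f, hf, hf'⟩ ⟨g, hg, hg'⟩
      refine ⟨f + g - f * g, ?_, ?_⟩
      · rintro x (hx | hx)
        · simp [hf x hx]
        · simp [hg x hx]
      · rw [Plus.of_sub, Plus.of_add, sub_smul, add_smul, ← star_star, hf', hg', smul_zero]; simp
    · intro x hx
      obtain ⟨f, hf, hfc⟩ := hc x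
      exact ⟨{y | (f : M → 𝔽) y = 1}, mem_nhdsWithin_of_mem_nhds (Cc.germ_eq_one.1 hf), f, fun y hy => hy, hfc⟩
  have : ρ * g = ρ := by
    ext y
    change (ρ : M → 𝔽) y * (g : M → 𝔽) y = (ρ : M → 𝔽) y
    by_cases hy : y ∈ tsupport (ρ : M → 𝔽)
    · rw [hg y hy, mul_one]
    · rw [image_eq_zero_of_notMem_tsupport hy, zero_mul]
  rw [← hρ, ← this, ← star_star, hgc, smul_zero]

variable (𝔽 n C)
/-- The quotient `C_x = C / N_x(C)`. -/
def Loc (x : M) : Type v := C ⧸ Nx 𝔽 n C x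

instance (x : M) : AddCommGroup (Loc 𝔽 n C x) := inferInstanceAs (AddCommGroup (C ⧸ Nx 𝔽 n C x))
instance (x : M) : Module (Plus (Cc 𝔽 n M)) (Loc 𝔽 n C x) := inferInstanceAs (Module _ (C ⧸ Nx 𝔽 n C x))

/-- The quotient projection `c ↦ c_x`. -/
def locMk (x : M) : C →ₗ[Plus (Cc 𝔽 n M)] Loc 𝔽 n C x := (Nx 𝔽 n C x).mkQ

variable {𝔽 n C}
theorem locMk_surjective (x : M) : Function.Surjective (locMk 𝔽 n C x) := (Nx 𝔽 n C x).mkQ_surjective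
theorem locMk_eq_zero {x : M} {c : C} : locMk 𝔽 n C x c = 0 ↔ c ∈ Nx 𝔽 n C x :=
  Submodule.Quotient.mk_eq_zero _
theorem locMk_eq_iff {x : M} {c d : C} : locMk 𝔽 n C x c = locMk 𝔽 n C x d ↔ c - d ∈ Nx 𝔽 n C x :=
  Submodule.Quotient.eq _

theorem smul_loc_eq {x : M} {a b : Plus (Cc 𝔽 n M)} (h : toGerm x a = toGerm x b) (q : Loc 𝔽 n C x) :
    a • q = b • q := by
  obtain ⟨c, rfl⟩ := locMk_surjective (𝔽 := 𝔽) (n := n) x q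
  rw [← map_smul, ← map_smul, locMk_eq_iff, ← sub_smul]
  exact smul_mem_Nx (by rw [map_sub, h, sub_self]) c

/-- The action of the ring of germs at `x` on `C_x`, determined by `f_x • c_x = (f c)_x`. -/
instance (x : M) : SMul (germRing 𝔽 n x) (Loc 𝔽 n C x) :=
  ⟨fun γ q => Function.surjInv (toGerm_surjective x) γ • q⟩

theorem toGerm_smul {x : M} (a : Plus (Cc 𝔽 n M)) (q : Loc 𝔽 n C x) : toGerm x a • q = a • q :=
  smul_loc_eq (Function.surjInv_eq (toGerm_surjective x) _) q

instance (x : M) : Module (germRing 𝔽 n x) (Loc 𝔽 n C x) :=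
  Function.Surjective.moduleLeft (toGerm x) (toGerm_surjective x) toGerm_smul

theorem germ_smul {x : M} (f : Cc 𝔽 n M) (c : C) :
    Cc.germ x f • locMk 𝔽 n C x c = locMk 𝔽 n C x (f ⋆ c) := by
  rw [← toGerm_of, toGerm_smul, map_smul]

instance germAlgebra (x : M) : Algebra (Plus (Cc 𝔽 n M)) (germRing 𝔽 n x) := (toGerm x).toAlgebra

instance (x : M) : IsScalarTower (Plus (Cc 𝔽 n M)) (germRing 𝔽 n x) (Loc 𝔽 n C x) where
  smul_assoc a γ q := by
    obtain ⟨b, rfl⟩ := toGerm_surjective x γ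
    rw [Algebra.smul_def, mul_smul]
    exact toGerm_smul a _

/-- The map `c ⊗ d ↦ c_x ⊗ d_x`. -/
def locTensor (x : M) : C ⊗[Plus (Cc 𝔽 n M)] C →ₗ[Plus (Cc 𝔽 n M)] Loc 𝔽 n C x ⊗[germRing 𝔽 n x] Loc 𝔽 n C x :=
  TensorProduct.mapOfCompatibleSMul (germRing 𝔽 n x) (Plus (Cc 𝔽 n M)) (Plus (Cc 𝔽 n M)) (Loc 𝔽 n C x) (Loc 𝔽 n C x) ∘ₗ
    TensorProduct.map (locMk 𝔽 n C x) (locMk 𝔽 n C x)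

theorem locTensor_tmul (x : M) (c d : C) : locTensor x (c ⊗ₜ d) = locMk 𝔽 n C x c ⊗ₜ[germRing 𝔽 n x] locMk 𝔽 n C x d := rfl

theorem locTensor_eq_zero {x : M} {t : C ⊗[Plus (Cc 𝔽 n M)] C} (h : locTensor x t = 0) :
    t ∈ Nx 𝔽 n _ x := by
  have e1 : ∀ c ∈ Nx 𝔽 n C x, ∀ d : C, c ⊗ₜ[Plus (Cc 𝔽 n M)] d ∈ Nx 𝔽 n (C ⊗[Plus (Cc 𝔽 n M)] C) x := fun c hc d =>
    Nx_map ((TensorProduct.mk (Plus (Cc 𝔽 n M)) C C).flip d) hc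
  have e2 : ∀ c : C, ∀ d ∈ Nx 𝔽 n C x, c ⊗ₜ[Plus (Cc 𝔽 n M)] d ∈ Nx 𝔽 n (C ⊗[Plus (Cc 𝔽 n M)] C) x := fun c d hd =>
    Nx_map (TensorProduct.mk (Plus (Cc 𝔽 n M)) C C c) hd
  let B1 : C →ₗ[Plus (Cc 𝔽 n M)] Loc 𝔽 n C x →ₗ[Plus (Cc 𝔽 n M)] Loc 𝔽 n (C ⊗[Plus (Cc 𝔽 n M)] C) x :=
    { toFun := fun c => (Nx 𝔽 n C x).liftQ (locMk 𝔽 n _ x ∘ₗ TensorProduct.mk (Plus (Cc 𝔽 n M)) C C c)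
        (fun d hd => locMk_eq_zero.2 (e2 c d hd))
      map_add' := fun c d => by
        ext q; obtain ⟨q, rfl⟩ := locMk_surjective (𝔽 := 𝔽) (n := n) x q
        exact (congrArg (locMk 𝔽 n _ x) (TensorProduct.add_tmul c d q)).trans (map_add _ _ _)
      map_smul' := fun a c => by
        ext q; obtain ⟨q, rfl⟩ := locMk_surjective (𝔽 := 𝔽) (n := n) x q
        exact (map_smul (locMk 𝔽 n _ x) a (c ⊗ₜ q)) }
  let B2 : Loc 𝔽 n C x →ₗ[Plus (Cc 𝔽 n M)] Loc 𝔽 n C x →ₗ[Plus (Cc 𝔽 n M)] Loc 𝔽 n (C ⊗[Plus (Cc 𝔽 n M)] C) x :=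
    (Nx 𝔽 n C x).liftQ B1 (fun c hc => by
      refine LinearMap.mem_ker.2 ?_
      ext q; obtain ⟨q, rfl⟩ := locMk_surjective (𝔽 := 𝔽) (n := n) x q
      exact locMk_eq_zero.2 (e1 c hc q))
  let B3 : Loc 𝔽 n C x →ₗ[germRing 𝔽 n x] Loc 𝔽 n C x →ₗ[germRing 𝔽 n x] Loc 𝔽 n (C ⊗[Plus (Cc 𝔽 n M)] C) x :=
    LinearMap.mk₂ _ (fun p q => B2 p q) (fun p p' q => by simp)
      (fun γ p q => by
        obtain ⟨a, rfl⟩ := toGerm_surjective x γ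
        rw [toGerm_smul, toGerm_smul, map_smul, LinearMap.smul_apply])
      (fun p q q' => by simp)
      (fun γ p q => by
        obtain ⟨a, rfl⟩ := toGerm_surjective x γ
        rw [toGerm_smul, toGerm_smul, map_smul])
  have key : ∀ t : C ⊗[Plus (Cc 𝔽 n M)] C, TensorProduct.lift B3 (locTensor x t) = locMk 𝔽 n _ x t := by
    intro t
    induction t using TensorProduct.induction_on with
    | zero => simp
    | tmul c d => rfl
    | add s t hs ht => rw [map_add, map_add, hs, ht, map_add]
  rw [← locMk_eq_zero, ← key, h, map_zero]

theorem germRing_smul_eq_zero {x : M} {Q : Type*} [AddCommGroup Q] [Module (Plus (Cc 𝔽 n M)) Q]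
    [Module (germRing 𝔽 n x) Q] [IsScalarTower (Plus (Cc 𝔽 n M)) (germRing 𝔽 n x) Q]
    (φ : C →ₗ[Plus (Cc 𝔽 n M)] Q) {c : C} (hc : c ∈ Nx 𝔽 n C x) : φ c = 0 := by
  obtain ⟨f, hf, hfc⟩ := hc
  have : (1 : germRing 𝔽 n x) • φ c = Plus.of f • φ c := by
    rw [← algebraMap_smul (germRing 𝔽 n x) (Plus.of f)]
    congr 1
    exact ((toGerm_of x f).trans hf).symm
  rw [one_smul] at this
  rw [this, ← map_smul, hfc, map_zero]

/-- The map `f ↦ f_x` as a linear map. -/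
def germLin (x : M) : Cc 𝔽 n M →ₗ[Plus (Cc 𝔽 n M)] germRing 𝔽 n x where
  toFun f := Cc.germ x f
  map_add' := map_add _
  map_smul' a f := by
    rw [smul_def, map_add, map_zsmul, map_mul, Algebra.smul_def]
    change _ = toGerm x a * _
    rw [toGerm, Plus.lift_apply, add_mul]
    simp

variable (𝔽 n C)
variable [NUCoalgebra (Cc 𝔽 n M) C]

/-- The comultiplication `Δ_x` of `C_x` over the ring of germs at `x`, induced by `Δ`. -/
def locComul (x : M) : Loc 𝔽 n C x →ₗ[Plus (Cc 𝔽 n M)] Loc 𝔽 n C x ⊗[germRing 𝔽 n x] Loc 𝔽 n C x :=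
  (Nx 𝔽 n C x).liftQ (locTensor x ∘ₗ NUCoalgebra.comul (R := Cc 𝔽 n M))
    (fun _ hc => LinearMap.mem_ker.2 <| germRing_smul_eq_zero _ hc)

/-- The counit `ε_x` of `C_x`, induced by `ε`. -/
def locCounit (x : M) : Loc 𝔽 n C x →ₗ[Plus (Cc 𝔽 n M)] germRing 𝔽 n x :=
  (Nx 𝔽 n C x).liftQ (germLin x ∘ₗ NUCoalgebra.counit (R := Cc 𝔽 n M))
    (fun _ hc => LinearMap.mem_ker.2 <| germRing_smul_eq_zero _ hc)

/-- The set of grouplike elements of `C_x`. -/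
def grouplikes (x : M) : Set (Loc 𝔽 n C x) :=
  {ζ | locComul 𝔽 n C x ζ = ζ ⊗ₜ[germRing 𝔽 n x] ζ ∧ locCounit 𝔽 n C x ζ = 1}

variable (M) in
/-- The set of weakly grouplike elements of `C`. -/
def weaklyGrouplike : Set C := {c | ∃ c' : C, NUCoalgebra.comul (R := Cc 𝔽 n M) c = c ⊗ₜ[Plus (Cc 𝔽 n M)] c'}

end Loc

end
end SheafCoalg

namespace SheafCoalg
noncomputable section

/-- A sheaf (of sets) on the manifold `M`, given as its total space: a smooth manifold, not necessarily
Hausdorff, with a local diffeomorphism to `M`. -/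
structure ManifoldSheaf (n : ℕ) (M : Type u) [TopologicalSpace M] [ChartedSpace (EuclideanSpace ℝ (Fin n)) M] where
  /-- the total space -/
  carrier : Type w
  [topology : TopologicalSpace carrier]
  [charts : ChartedSpace (EuclideanSpace ℝ (Fin n)) carrier]
  [manifold : IsManifold (𝓡 n) ∞ carrier]
  /-- the projection -/
  proj : carrier → M
  isLocalDiffeomorph : IsLocalDiffeomorph (𝓡 n) (𝓡 n) ∞ proj

attribute [instance] ManifoldSheaf.topology ManifoldSheaf.charts ManifoldSheaf.manifold

instance (n : ℕ) (M : Type u) [TopologicalSpace M] [ChartedSpace (EuclideanSpace ℝ (Fin n)) M] :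
    CoeSort (ManifoldSheaf.{u, w} n M) (Type w) := ⟨ManifoldSheaf.carrier⟩

section Ext
variable {𝔽 : Type} [RCLike 𝔽] {E : Type w} [TopologicalSpace E]

open Classical in
/-- The extension by zero of (the germs of) `f` from `U` to a not necessarily continuous section of the
sheaf of germs of functions on `E`. -/
def extSection (U : Set E) (f : E → 𝔽) : ∀ y : E, (𝓝 y).Germ 𝔽 :=
  fun y => if y ∈ U then (f : (𝓝 y).Germ 𝔽) else 0

theorem extSection_of_mem {U : Set E} (f : E → 𝔽) {y : E} (hy : y ∈ U) : extSection U f y = f := if_pos hy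
theorem extSection_of_notMem {U : Set E} (f : E → 𝔽) {y : E} (hy : y ∉ U) : extSection U f y = 0 := if_neg hy

theorem extSection_add (U : Set E) (f g : E → 𝔽) : extSection U (f + g) = extSection U f + extSection U g := by
  ext y
  by_cases hy : y ∈ U
  · rw [Pi.add_apply, extSection_of_mem _ hy, extSection_of_mem _ hy, extSection_of_mem _ hy]; rfl
  · rw [Pi.add_apply, extSection_of_notMem _ hy, extSection_of_notMem _ hy, extSection_of_notMem _ hy, add_zero]

theorem extSection_sub (U : Set E) (f g : E → 𝔽) : extSection U (f - g) = extSection U f - extSection U g := by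
  rw [eq_sub_iff_add_eq, ← extSection_add, sub_add_cancel]

theorem extSection_congr {U : Set E} (hU : IsOpen U) {f g : E → 𝔽} (h : ∀ y ∈ U, f y = g y) :
    extSection U f = extSection U g := by
  ext y
  by_cases hy : y ∈ U
  · rw [extSection_of_mem _ hy, extSection_of_mem _ hy]
    exact Germ.coe_eq.2 (by filter_upwards [hU.mem_nhds hy] with z hz using h z hz)
  · rw [extSection_of_notMem _ hy, extSection_of_notMem _ hy]

variable (n : ℕ)
variable [ChartedSpace (EuclideanSpace ℝ (Fin n)) E]

/-- `f` restricts to a smooth function with compact support on the Hausdorff open subset `U`. -/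
structure IsCcOn (U : Set E) (f : E → 𝔽) : Prop where
  isOpen : IsOpen U
  t2 : T2Space U
  smooth : ContMDiffOn (𝓡 n) 𝓘(ℝ, 𝔽) ∞ f U
  compact : ∃ K ⊆ U, IsCompact K ∧ ∀ y ∈ U, y ∉ K → f y = 0

variable (𝔽 E) in
/-- The group of all finite sums of extensions by zero of smooth functions with compact support, defined
on Hausdorff open subsets of the (not necessarily Hausdorff) manifold `E`. It is a vector space over `𝔽`. -/
def ccSections : AddSubgroup (∀ y : E, (𝓝 y).Germ 𝔽) :=
  AddSubgroup.closure {u | ∃ (U : Set E) (f : E → 𝔽), IsCcOn n U f ∧ u = extSection U f}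

end Ext

variable {𝔽 : Type} [RCLike 𝔽] {n : ℕ} {M : Type u} [TopologicalSpace M] [ChartedSpace (EuclideanSpace ℝ (Fin n)) M] 

section Sec
variable (𝔽) {X : Type w} [TopologicalSpace X]

/-- The not necessarily continuous sections of the sheaf of germs of functions on `X`, where `X` is a space
over `M`. -/
def Sec (_p : X → M) : Type w := ∀ y : X, (𝓝 y).Germ 𝔽

variable (p : X → M)
instance : CommRing (Sec 𝔽 p) := inferInstanceAs (CommRing (∀ y : X, (𝓝 y).Germ 𝔽))

variable {𝔽}
theorem Sec.ext {p : X → M} {u v : Sec 𝔽 p} (h : ∀ y, u y = v y) : u = v := funext h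
variable {p} in
theorem Sec.add_apply (u v : Sec 𝔽 p) (y : X) : (u + v) y = u y + v y := rfl
variable {p} in
theorem Sec.mul_apply (u v : Sec 𝔽 p) (y : X) : (u * v) y = u y * v y := rfl

/-- The germs of `f ∘ p`. The ring of functions with compact support on `M` acts by multiplication with it. -/
def Sec.comap : Cc 𝔽 n M →ₙ+* Sec 𝔽 p where
  toFun f := fun y => (((f : M → 𝔽) ∘ p : X → 𝔽) : (𝓝 y).Germ 𝔽)
  map_mul' _ _ := rfl
  map_zero' := rfl
  map_add' _ _ := rfl

instance : Module (Plus (Cc 𝔽 n M)) (Sec 𝔽 p) := Module.compHom _ (Plus.lift (Sec.comap (n := n) p))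

variable {p}
theorem Sec.smul_apply (a : Plus (Cc 𝔽 n M)) (u : Sec 𝔽 p) (y : X) :
    (a • u) y = ((fun z => (a.int : 𝔽) + (a.part : M → 𝔽) (p z) : X → 𝔽) : (𝓝 y).Germ 𝔽) * u y := rfl

theorem Sec.star_apply (f : Cc 𝔽 n M) (u : Sec 𝔽 p) (y : X) :
    (f ⋆ u) y = (((f : M → 𝔽) ∘ p : X → 𝔽) : (𝓝 y).Germ 𝔽) * u y := by
  rw [Sec.smul_apply]
  congr 2
  ext z
  rw [Plus.int_of, Plus.part_of]; simp

theorem Sec.int_smul_def (k : ℤ) (u : Sec 𝔽 p) : (k : Plus (Cc 𝔽 n M)) • u = k • u := Int.cast_smul_eq_zsmul _ k u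

theorem Sec.mul_smul_comm' (a : Plus (Cc 𝔽 n M)) (u v : Sec 𝔽 p) : u * (a • v) = a • (u * v) :=
  mul_left_comm (G := Sec 𝔽 p) _ _ _
theorem Sec.smul_mul (a : Plus (Cc 𝔽 n M)) (u v : Sec 𝔽 p) : (a • u) * v = a • (u * v) :=
  mul_assoc (G := Sec 𝔽 p) _ _ _

theorem Sec.toGerm_eq_zero {a : Plus (Cc 𝔽 n M)} {u : Sec 𝔽 p} {y : X} (hp : 𝓝 (p y) ≤ map p (𝓝 y))
    (hu : u y = 1) (h : (a • u) y = 0) : toGerm (p y) a = 0 := by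
  rw [Sec.smul_apply, hu, mul_one] at h
  have h1 : ∀ᶠ z in 𝓝 y, (a.int : 𝔽) + (a.part : M → 𝔽) (p z) = 0 := Germ.coe_eq.1 h
  have h2 : ∀ᶠ z in 𝓝 (p y), (a.int : 𝔽) + (a.part : M → 𝔽) z = 0 := hp h1
  exact Subtype.ext (Germ.coe_eq.2 h2)

end Sec

namespace ManifoldSheaf
variable (E : ManifoldSheaf.{u, w} n M)

theorem continuous_proj : Continuous E.proj := E.isLocalDiffeomorph.contMDiff.continuous
theorem isOpenMap_proj : IsOpenMap E.proj := E.isLocalDiffeomorph.isOpenMap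

/-- `U` is an elementary subset of `E`: it is open and `π` is injective on it. -/
def IsElementary (U : Set E) : Prop := IsOpen U ∧ Set.InjOn E.proj U

variable {E}
theorem IsElementary.mono {U V : Set E} (hU : E.IsElementary U) (hV : IsOpen V) (h : V ⊆ U) : E.IsElementary V :=
  ⟨hV, hU.2.mono h⟩

theorem exists_isElementary (y : E) : ∃ U, E.IsElementary U ∧ y ∈ U := by
  obtain ⟨Φ, hy, hΦ⟩ := E.isLocalDiffeomorph y
  exact ⟨Φ.source, ⟨Φ.open_source, fun a ha b hb hab => Φ.injOn ha hb (by rw [← hΦ ha, ← hΦ hb, hab])⟩, hy⟩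

theorem IsElementary.isOpenEmbedding {U : Set E} (hU : E.IsElementary U) :
    Topology.IsOpenEmbedding (U.domRestrict E.proj) := by
  refine .of_continuous_injective_isOpenMap (E.continuous_proj.continuousOn.domRestrict)
    (Set.injOn_iff_injective.1 hU.2) (E.isOpenMap_proj.domRestrict hU.1)

theorem IsElementary.isCompact {U : Set E} (hU : E.IsElementary U) {K : Set M} (hK : IsCompact K)
    (hKU : K ⊆ E.proj '' U) : IsCompact (U ∩ E.proj ⁻¹' K) := by
  have h1 : IsCompact (U.domRestrict E.proj ⁻¹' K) :=
    hU.isOpenEmbedding.isInducing.isCompact_preimage' hK (by rwa [Set.range_domRestrict])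
  have h2 := h1.image continuous_subtype_val
  convert h2 using 1
  ext y
  simp [Set.domRestrict, and_comm]

variable (E) in
/-- The extension by zero of `f` from `U`. -/
def ext (U : Set E) (f : E → 𝔽) : Sec 𝔽 E.proj := extSection U f

theorem ext_of_mem {U : Set E} (f : E → 𝔽) {y : E} (hy : y ∈ U) : E.ext U f y = (f : (𝓝 y).Germ 𝔽) := if_pos hy
theorem ext_of_notMem {U : Set E} (f : E → 𝔽) {y : E} (hy : y ∉ U) : E.ext U f y = 0 := if_neg hy

variable (E) in
/-- The extension by zero of `h ∘ π|_U`. -/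
def elem (U : Set E) (h : Cc 𝔽 n M) : Sec 𝔽 E.proj := E.ext U ((h : M → 𝔽) ∘ E.proj)

theorem IsElementary.isCcOn [T2Space M] {U : Set E} (hU : E.IsElementary U) {h : Cc 𝔽 n M}
    (hh : tsupport (h : M → 𝔽) ⊆ E.proj '' U) : IsCcOn n U ((h : M → 𝔽) ∘ E.proj) where
  isOpen := hU.1
  t2 := T2Space.of_injective_continuous hU.isOpenEmbedding.injective hU.isOpenEmbedding.continuous
  smooth := (h.2.1.comp E.isLocalDiffeomorph.contMDiff).contMDiffOn
  compact := ⟨_, Set.inter_subset_left, hU.isCompact h.2.2.isCompact hh, fun y hy hyK =>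
    image_eq_zero_of_notMem_tsupport (f := (h : M → 𝔽)) fun hc => hyK ⟨hy, hc⟩⟩

theorem star_ext (U : Set E) (f : Cc 𝔽 n M) (g : E → 𝔽) :
    f ⋆ E.ext U g = E.ext U (((f : M → 𝔽) ∘ E.proj) * g) := by
  refine Sec.ext fun y => ?_
  rw [Sec.star_apply]
  by_cases hy : y ∈ U
  · rw [ext_of_mem _ hy, ext_of_mem _ hy]; rfl
  · rw [ext_of_notMem _ hy, ext_of_notMem _ hy, mul_zero]

theorem star_elem (U : Set E) (f h : Cc 𝔽 n M) : f ⋆ E.elem U h = E.elem U (f * h) := star_ext _ _ _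

variable (𝔽 E) in
/-- The additive group underlying `E.cc 𝔽`. -/
def ccAdd : AddSubgroup (Sec 𝔽 E.proj) := ccSections 𝔽 E.carrier n

variable (𝔽 E) in
/-- The space of smooth functions with compact support on the total space of the sheaf `E`, as a module over
the smooth functions with compact support on `M`. -/
def cc : Submodule (Plus (Cc 𝔽 n M)) (Sec 𝔽 E.proj) where
  carrier := E.ccAdd 𝔽
  add_mem' := fun ha hb => (E.ccAdd 𝔽).add_mem ha hb
  zero_mem' := (E.ccAdd 𝔽).zero_mem
  smul_mem' := by
    intro a u hu
    rw [Plus.eq_int_add_of a, add_smul, Sec.int_smul_def]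
    refine (E.ccAdd 𝔽).add_mem ((E.ccAdd 𝔽).zsmul_mem hu _) ?_
    generalize a.part = f
    refine AddSubgroup.closure_induction (G := Sec 𝔽 E.proj) (p := fun u _ => f ⋆ (u : Sec 𝔽 E.proj) ∈ E.ccAdd 𝔽)
      ?_ ?_ ?_ ?_ hu
    · rintro _ ⟨U, g, hg, rfl⟩
      refine AddSubgroup.subset_closure ⟨U, ((f : M → 𝔽) ∘ E.proj) * g, ?_, star_ext U f g⟩
      obtain ⟨K, hKU, hK, hgK⟩ := hg.compact
      refine ⟨hg.isOpen, hg.t2, fun y hy => ?_, K, hKU, hK, fun y hy hyK => ?_⟩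
      · exact (contMDiffAt_mul (f.2.1.comp E.isLocalDiffeomorph.contMDiff y)
          (hg.smooth.contMDiffAt (hg.isOpen.mem_nhds hy))).contMDiffWithinAt
      · rw [Pi.mul_apply, hgK y hy hyK, mul_zero]
    · rw [smul_zero]
      exact zero_mem _
    · intro u v _ _ hu hv
      rw [smul_add]
      exact add_mem hu hv
    · intro u _ hu
      rw [smul_neg]
      exact neg_mem hu

theorem IsElementary.elem_mem [T2Space M] {U : Set E} (hU : E.IsElementary U) {h : Cc 𝔽 n M}
    (hh : tsupport (h : M → 𝔽) ⊆ E.proj '' U) : E.elem U h ∈ E.cc 𝔽 :=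
  show E.elem U h ∈ E.ccAdd 𝔽 from AddSubgroup.subset_closure ⟨U, _, hU.isCcOn hh, rfl⟩

theorem cc_induction [T2Space M] [IsManifold (𝓡 n) ∞ M] (𝓑 : Set (Set E)) (h𝓑 : ∀ V ∈ 𝓑, E.IsElementary V) (hcov : ∀ y : E, ∃ V ∈ 𝓑, y ∈ V)
    (S : AddSubgroup (Sec 𝔽 E.proj))
    (hS : ∀ V ∈ 𝓑, ∀ h : Cc 𝔽 n M, tsupport (h : M → 𝔽) ⊆ E.proj '' V → E.elem V h ∈ S)
    {u : Sec 𝔽 E.proj} (hu : u ∈ E.cc 𝔽) : u ∈ S := by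
  have hu' : u ∈ E.ccAdd 𝔽 := hu
  refine (AddSubgroup.closure_le (G := Sec 𝔽 E.proj) S).2 ?_ hu'
  rintro _ ⟨U, f, hf, rfl⟩
  obtain ⟨K, hKU, hK, hfK⟩ := hf.compact
  have hUo := hf.isOpen
  have ht2 := hf.t2
  obtain ⟨g, hg1, hg, hgS⟩ : ∃ g : E → 𝔽, (∀ y ∈ K, g y = 1) ∧ ContMDiffOn (𝓡 n) 𝓘(ℝ, 𝔽) ∞ g U ∧
      ∀ f : E → 𝔽, ContMDiffOn (𝓡 n) 𝓘(ℝ, 𝔽) ∞ f U → E.ext U (f * g) ∈ S := by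
    clear hfK hf f
    refine IsCompact.induction_on (p := fun K => ∃ g : E → 𝔽, (∀ y ∈ K, g y = 1) ∧
      ContMDiffOn (𝓡 n) 𝓘(ℝ, 𝔽) ∞ g U ∧ ∀ f : E → 𝔽, ContMDiffOn (𝓡 n) 𝓘(ℝ, 𝔽) ∞ f U →
        E.ext U (f * g) ∈ S) hK ⟨0, by simp, contMDiffOn_const, fun f _ => ?_⟩ ?_ ?_ ?_
    · rw [mul_zero]
      have : E.ext U (0 : E → 𝔽) = 0 := ?_
      · rw [this]; exact zero_mem S
      refine Sec.ext fun y => ?_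
      by_cases hy : y ∈ U
      · rw [ext_of_mem _ hy]; rfl
      · rw [ext_of_notMem _ hy]; rfl
    · rintro s t hst ⟨g, h1, h2⟩
      exact ⟨g, fun y hy => h1 y (hst hy), h2⟩
    · rintro s t ⟨g, hg, hgs, hgS⟩ ⟨k, hk, hks, hkS⟩
      have mulOn : ∀ {a b : E → 𝔽}, ContMDiffOn (𝓡 n) 𝓘(ℝ, 𝔽) ∞ a U → ContMDiffOn (𝓡 n) 𝓘(ℝ, 𝔽) ∞ b U →
          ContMDiffOn (𝓡 n) 𝓘(ℝ, 𝔽) ∞ (a * b) U := fun ha hb y hy =>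
        (contMDiffAt_mul (ha.contMDiffAt (hUo.mem_nhds hy)) (hb.contMDiffAt (hUo.mem_nhds hy))).contMDiffWithinAt
      refine ⟨g + k - g * k, ?_, (hgs.add hks).sub (mulOn hgs hks), fun f hf => ?_⟩
      · rintro y (hy | hy)
        · simp [hg y hy]
        · simp [hk y hy]
      · have : f * (g + k - g * k) = f * g + f * k - (f * g) * k := by ring
        rw [this]
        change extSection U _ ∈ S
        rw [extSection_sub, extSection_add]
        exact S.sub_mem (S.add_mem (hgS f hf) (hkS f hf)) (hkS _ (mulOn hf hgs))
    · intro y hyK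
      obtain ⟨V, hVB, hyV⟩ := hcov y
      obtain ⟨Φ, hy, hΦ⟩ := E.isLocalDiffeomorph y
      set V' : Set E := Φ.source ∩ U ∩ V with hV'
      have hV'o : IsOpen V' := (Φ.open_source.inter hUo).inter (h𝓑 V hVB).1
      have hyV' : y ∈ V' := ⟨⟨hy, hKU hyK⟩, hyV⟩
      have hel : E.IsElementary V' := (h𝓑 V hVB).mono hV'o Set.inter_subset_right
      obtain ⟨b, hb1, hbs⟩ := Cc.exists_bump (𝔽 := 𝔽) (n := n) (E.proj y)
        ((E.isOpenMap_proj _ hV'o).mem_nhds ⟨y, hyV', rfl⟩)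
      set L : Set E := V' ∩ E.proj ⁻¹' tsupport (b : M → 𝔽) with hL
      have hLc : IsCompact L := hel.isCompact b.2.2.isCompact hbs
      have hLU : L ⊆ U := fun z hz => hz.1.1.2
      have hopen : ∀ z ∈ U, z ∉ L → Lᶜ ∈ 𝓝 z := by
        intro z hz hzL
        have h1 : IsClosed ((↑) ⁻¹' L : Set U) :=
          (Topology.IsInducing.subtypeVal.isCompact_preimage' hLc (by simpa using hLU)).isClosed
        have h2 := hUo.isOpenMap_subtype_val _ h1.isOpen_compl
        filter_upwards [h2.mem_nhds ⟨⟨z, hz⟩, hzL, rfl⟩]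
        rintro _ ⟨a, ha, rfl⟩
        exact ha
      set g : E → 𝔽 := V'.indicator ((b : M → 𝔽) ∘ E.proj) with hg
      have hg0 : ∀ z ∈ U, z ∉ V' → g =ᶠ[𝓝 z] 0 := by
        intro z hz hzV
        filter_upwards [hopen z hz fun h => hzV h.1] with a ha
        by_cases haV : a ∈ V'
        · rw [hg, Set.indicator_of_mem haV]
          exact image_eq_zero_of_notMem_tsupport (f := (b : M → 𝔽)) fun h => ha ⟨haV, h⟩
        · rw [hg, Set.indicator_of_notMem haV]; rfl
      have hg1 : ∀ z ∈ V', g =ᶠ[𝓝 z] ((b : M → 𝔽) ∘ E.proj) := fun z hz => by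
        filter_upwards [hV'o.mem_nhds hz] with a ha
        rw [hg, Set.indicator_of_mem ha]
      have hgs : ContMDiffOn (𝓡 n) 𝓘(ℝ, 𝔽) ∞ g U := by
        intro z hz
        refine ContMDiffAt.contMDiffWithinAt ?_
        by_cases hzV : z ∈ V'
        · exact (b.2.1.comp E.isLocalDiffeomorph.contMDiff z).congr_of_eventuallyEq (hg1 z hzV)
        · exact (contMDiffAt_const (c := (0 : 𝔽))).congr_of_eventuallyEq (hg0 z hz hzV)
      refine ⟨{z | (b : M → 𝔽) (E.proj z) = 1} ∩ V', mem_nhdsWithin_of_mem_nhds (inter_mem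
        (E.continuous_proj.continuousAt.eventually hb1) (hV'o.mem_nhds hyV')), g, ?_, hgs, ?_⟩
      · rintro z ⟨hz, hzV⟩
        rw [hg, Set.indicator_of_mem hzV]; exact hz
      intro f hf
      have hmem : (fun x => (b : M → 𝔽) x * f (Φ.invFun x)) ∈ Cc 𝔽 n M := by
        refine Cc.mem_of (W := E.proj '' V') b.2.2.isCompact hbs ?_ ?_
        · rintro _ ⟨z, hz, rfl⟩
          have hz1 : E.proj z ∈ Φ.target := by rw [hΦ hz.1.1]; exact Φ.map_source hz.1.1
          have hz2 : Φ.invFun (E.proj z) = z := by rw [hΦ hz.1.1]; exact Φ.left_inv hz.1.1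
          refine contMDiffAt_mul (b.2.1 _) ?_
          refine ContMDiffAt.comp (g := f) (f := Φ.invFun) (E.proj z) ?_
            (Φ.contMDiffOn_invFun.contMDiffAt (Φ.open_target.mem_nhds hz1))
          rw [hz2]
          exact hf.contMDiffAt (hUo.mem_nhds hz.1.2)
        · intro x hx
          rw [image_eq_zero_of_notMem_tsupport hx, zero_mul]
      have hsupp : tsupport (fun x => (b : M → 𝔽) x * f (Φ.invFun x)) ⊆ tsupport (b : M → 𝔽) :=
        closure_mono fun x hx hx0 => hx (by
          change (b : M → 𝔽) x * _ = 0
          rw [hx0, zero_mul])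
      convert hS V hVB ⟨_, hmem⟩ (hsupp.trans (hbs.trans (Set.image_mono Set.inter_subset_right))) using 1
      refine Sec.ext fun z => ?_
      by_cases hzV' : z ∈ V'
      · rw [elem, ext_of_mem _ hzV'.1.2, ext_of_mem _ hzV'.2]
        refine Germ.coe_eq.2 ?_
        filter_upwards [hg1 z hzV', hV'o.mem_nhds hzV'] with a ha haV
        have : Φ.invFun (E.proj a) = a := by rw [hΦ haV.1.1]; exact Φ.left_inv haV.1.1
        change f a * g a = (b : M → 𝔽) (E.proj a) * f (Φ.invFun (E.proj a))
        rw [ha, this, mul_comm]; rfl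
      · have e1 : E.ext U (f * g) z = 0 := by
          by_cases hzU : z ∈ U
          · rw [ext_of_mem _ hzU]
            refine Germ.coe_eq.2 ?_
            filter_upwards [hg0 z hzU hzV'] with a ha
            change f a * g a = 0
            rw [ha]; exact mul_zero _
          · rw [ext_of_notMem _ hzU]
        rw [e1]
        by_cases hzV : z ∈ V
        · rw [elem, ext_of_mem _ hzV]
          have hn : E.proj z ∉ tsupport (b : M → 𝔽) := fun hc => by
            obtain ⟨a, ha, haz⟩ := hbs hc
            exact hzV' ((h𝓑 V hVB).2 ha.2 hzV haz ▸ ha)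
          refine (Germ.coe_eq.2 ?_ : ((0 : E → 𝔽) : (𝓝 z).Germ 𝔽) = _)
          filter_upwards [E.continuous_proj.continuousAt.eventually
            ((isClosed_tsupport (b : M → 𝔽)).isOpen_compl.mem_nhds hn)] with a ha
          change 0 = (b : M → 𝔽) (E.proj a) * _
          rw [image_eq_zero_of_notMem_tsupport (f := (b : M → 𝔽)) ha, zero_mul]
        · rw [elem, ext_of_notMem _ hzV]
  have : E.ext U f = E.ext U (f * g) := extSection_congr hUo fun y hy => by
    by_cases hyK : y ∈ K
    · rw [Pi.mul_apply, hg1 y hyK, mul_one]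
    · rw [Pi.mul_apply, hfK y hy hyK, zero_mul]
  change E.ext U f ∈ S
  rw [this]
  exact hgS f hf.smooth

end ManifoldSheaf

end
end SheafCoalg

namespace SheafCoalg
noncomputable section

theorem lu_add {R : Type*} [NonUnitalCommRing R] {C : Type*} [AddCommGroup C] [Module (Plus R) C]
    {c d : C} (hc : ∃ r : R, r ⋆ c = c) (hd : ∃ r : R, r ⋆ d = d) : ∃ r : R, r ⋆ (c + d) = c + d := by
  obtain ⟨r, hr⟩ := hc
  obtain ⟨q, hq⟩ := hd
  have key : ∀ c : C, (r + q - r * q) ⋆ c = r ⋆ c + q ⋆ c - r ⋆ q ⋆ c := fun c => by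
    rw [star_star, Plus.of_sub, Plus.of_add, sub_smul, add_smul]
  refine ⟨r + q - r * q, ?_⟩
  have e1 : (r + q - r * q) ⋆ c = c := by
    rw [key, star_star, mul_comm, ← star_star, hr]; abel
  have e2 : (r + q - r * q) ⋆ d = d := by
    rw [key, hq]; abel
  rw [smul_add, e1, e2]

theorem LocallyUnitary.tensor {R : Type*} [NonUnitalCommRing R] {C : Type*} [AddCommGroup C] [Module (Plus R) C]
    {D : Type*} [AddCommGroup D] [Module (Plus R) D] (hC : LocallyUnitary R C) :
    LocallyUnitary R (C ⊗[Plus R] D) := by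
  refine locallyUnitary_of_forall fun t => ?_
  induction t using TensorProduct.induction_on with
  | zero => exact ⟨0, smul_zero _⟩
  | tmul c d =>
    obtain ⟨r, hr⟩ := hC {c}
    exact ⟨r, by rw [TensorProduct.smul_tmul', hr c (Finset.mem_singleton_self c)]⟩
  | add s t hs ht => exact lu_add hs ht

variable {𝔽 : Type} [RCLike 𝔽] {n : ℕ} {M : Type u} [TopologicalSpace M] [ChartedSpace (EuclideanSpace ℝ (Fin n)) M]

namespace ManifoldSheaf

/-- The fibre product `E ×_M F`. -/
def FibreProduct (E : ManifoldSheaf.{u, w} n M) (F : ManifoldSheaf.{u, w₂} n M) : Type (max w w₂) :=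
  {p : E × F // E.proj p.1 = F.proj p.2}

section
variable (E : ManifoldSheaf.{u, w} n M) (F : ManifoldSheaf.{u, w₂} n M)
instance : TopologicalSpace (FibreProduct E F) := inferInstanceAs (TopologicalSpace {p : E × F // E.proj p.1 = F.proj p.2})

variable {E F} in
/-- The point `(y, z)`. -/
def FibreProduct.mk (y : E) (z : F) (h : E.proj y = F.proj z) : FibreProduct E F := ⟨(y, z), h⟩
/-- first projection -/
def pr₁ (p : FibreProduct E F) : E := p.1.1
/-- second projection -/
def pr₂ (p : FibreProduct E F) : F := p.1.2
/-- the projection to `M` -/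
def fibProj (p : FibreProduct E F) : M := E.proj (pr₁ E F p)

theorem continuous_pr₁ : Continuous (pr₁ E F) := continuous_fst.comp continuous_subtype_val
theorem continuous_pr₂ : Continuous (pr₂ E F) := continuous_snd.comp continuous_subtype_val
theorem continuous_fibProj : Continuous (fibProj E F) := E.continuous_proj.comp (continuous_pr₁ E F)

theorem fibProj_eq (p : FibreProduct E F) : fibProj E F p = F.proj (pr₂ E F p) := p.2

theorem nhds_le_fibProj (p : FibreProduct E F) : 𝓝 (fibProj E F p) ≤ map (fibProj E F) (𝓝 p) := by
  intro s hs
  have hs : fibProj E F ⁻¹' s ∈ 𝓝 p := hs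
  obtain ⟨t, ht, hts⟩ := mem_nhds_subtype _ _ _ |>.1 hs
  obtain ⟨A, hA, B, hB, hAB⟩ := mem_nhds_prod_iff.1 ht
  filter_upwards [E.isOpenMap_proj.image_mem_nhds hA,
    (fibProj_eq E F p) ▸ F.isOpenMap_proj.image_mem_nhds hB]
  rintro _ ⟨a, ha, rfl⟩ ⟨b, hb, hba⟩
  exact hts (show (⟨(a, b), hba.symm⟩ : FibreProduct E F).1 ∈ t from hAB ⟨ha, hb⟩)
end

section Pull
variable {X Y : Type*} [TopologicalSpace X] [TopologicalSpace Y]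
/-- The homomorphism `φ^*_x` from germs at `φ x` to germs at `x`. -/
def pullGerm (φ : X → Y) (hφ : Continuous φ) (x : X) (γ : (𝓝 (φ x)).Germ 𝔽) : (𝓝 x).Germ 𝔽 :=
  γ.compTendsto φ hφ.continuousAt
theorem pullGerm_add (φ : X → Y) (hφ : Continuous φ) (x : X) (γ δ : (𝓝 (φ x)).Germ 𝔽) :
    pullGerm φ hφ x (γ + δ) = pullGerm φ hφ x γ + pullGerm φ hφ x δ :=
  Germ.inductionOn₂ γ δ fun _ _ => rfl
theorem pullGerm_mul (φ : X → Y) (hφ : Continuous φ) (x : X) (γ δ : (𝓝 (φ x)).Germ 𝔽) :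
    pullGerm φ hφ x (γ * δ) = pullGerm φ hφ x γ * pullGerm φ hφ x δ :=
  Germ.inductionOn₂ γ δ fun _ _ => rfl
theorem pullGerm_zero (φ : X → Y) (hφ : Continuous φ) (x : X) : pullGerm (𝔽 := 𝔽) φ hφ x 0 = 0 := rfl
theorem pullGerm_one (φ : X → Y) (hφ : Continuous φ) (x : X) : pullGerm (𝔽 := 𝔽) φ hφ x 1 = 1 := rfl
theorem pullGerm_coe (φ : X → Y) (hφ : Continuous φ) (x : X) (f : Y → 𝔽) :
    pullGerm φ hφ x (f : (𝓝 (φ x)).Germ 𝔽) = ((f ∘ φ : X → 𝔽) : (𝓝 x).Germ 𝔽) := rfl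
end Pull

section
variable {E : ManifoldSheaf.{u, w} n M} {F : ManifoldSheaf.{u, w₂} n M}

/-- The section `(y, z) ↦ u_y(pr₁) v_z(pr₂)` over the fibre product. -/
def boxProd (u : Sec 𝔽 E.proj) (v : Sec 𝔽 F.proj) : Sec 𝔽 (fibProj E F) := fun p =>
  pullGerm (pr₁ E F) (continuous_pr₁ E F) p (u (pr₁ E F p)) * pullGerm (pr₂ E F) (continuous_pr₂ E F) p (v (pr₂ E F p))

theorem boxProd_apply (u : Sec 𝔽 E.proj) (v : Sec 𝔽 F.proj) (p : FibreProduct E F) : boxProd u v p =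
  pullGerm (pr₁ E F) (continuous_pr₁ E F) p (u (pr₁ E F p)) * pullGerm (pr₂ E F) (continuous_pr₂ E F) p (v (pr₂ E F p)) := rfl

theorem boxProd_eq_one {u : Sec 𝔽 E.proj} {v : Sec 𝔽 F.proj} {p : FibreProduct E F}
    (hu : u (pr₁ E F p) = 1) (hv : v (pr₂ E F p) = 1) : boxProd u v p = 1 := by
  rw [boxProd_apply, hu, hv, pullGerm_one, pullGerm_one, mul_one]
theorem boxProd_eq_zero_left {u : Sec 𝔽 E.proj} {v : Sec 𝔽 F.proj} {p : FibreProduct E F}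
    (hu : u (pr₁ E F p) = 0) : boxProd u v p = 0 := by
  rw [boxProd_apply, hu, pullGerm_zero, zero_mul]
theorem boxProd_eq_zero_right {u : Sec 𝔽 E.proj} {v : Sec 𝔽 F.proj} {p : FibreProduct E F}
    (hv : v (pr₂ E F p) = 0) : boxProd u v p = 0 := by
  rw [boxProd_apply, hv, pullGerm_zero, mul_zero]

variable (𝔽 E F) in
/-- The map from the tensor product to sections over the fibre product, an isomorphism to its image. -/
def Omega : (E.cc 𝔽 ⊗[Plus (Cc 𝔽 n M)] F.cc 𝔽) →ₗ[Plus (Cc 𝔽 n M)] Sec 𝔽 (fibProj E F) :=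
  TensorProduct.lift <| LinearMap.mk₂ _ (fun u v => boxProd (u : Sec 𝔽 E.proj) (v : Sec 𝔽 F.proj))
    (fun u u' v => Sec.ext fun p => by
      rw [Sec.add_apply, boxProd_apply, boxProd_apply, boxProd_apply, ← add_mul, ← pullGerm_add]; rfl)
    (fun a u v => Sec.ext fun p => by
      rw [Sec.smul_apply, boxProd_apply, boxProd_apply, ← mul_assoc, Submodule.coe_smul, Sec.smul_apply, pullGerm_mul]; rfl)
    (fun u v v' => Sec.ext fun p => by
      rw [Sec.add_apply, boxProd_apply, boxProd_apply, boxProd_apply, ← mul_add, ← pullGerm_add]; rfl)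
    (fun a u v => Sec.ext fun p => by
      rw [Sec.smul_apply, boxProd_apply, boxProd_apply, mul_left_comm, Submodule.coe_smul, Sec.smul_apply, pullGerm_mul,
        pullGerm_coe]
      congr 3
      funext q
      exact congrArg (fun z => (a.int : 𝔽) + (a.part : M → 𝔽) z) (fibProj_eq E F q).symm)

theorem Omega_tmul (u : E.cc 𝔽) (v : F.cc 𝔽) : Omega 𝔽 E F (u ⊗ₜ v) = boxProd (u : Sec 𝔽 E.proj) (v : Sec 𝔽 F.proj) := rfl
end

section elem
variable {E : ManifoldSheaf.{u, w} n M}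

theorem elem_of_mem {U : Set E} (h : Cc 𝔽 n M) {y : E} (hy : y ∈ U) :
    E.elem U h y = (((h : M → 𝔽) ∘ E.proj : E → 𝔽) : (𝓝 y).Germ 𝔽) := ext_of_mem _ hy
theorem elem_of_notMem {U : Set E} (h : Cc 𝔽 n M) {y : E} (hy : y ∉ U) :
    E.elem U h y = 0 := ext_of_notMem _ hy

theorem coe_comp_eq {x : M} {y : E} (hy : E.proj y = x) {h g : M → 𝔽} (hg : h =ᶠ[𝓝 x] g) :
    ((h ∘ E.proj : E → 𝔽) : (𝓝 y).Germ 𝔽) = ((g ∘ E.proj : E → 𝔽) : (𝓝 y).Germ 𝔽) :=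
  by
  subst hy
  exact Germ.coe_eq.2 (E.continuous_proj.continuousAt.eventually hg)

theorem eventually_zero {h : M → 𝔽} {x : M} (hx : x ∉ tsupport h) : h =ᶠ[𝓝 x] 0 := by
  filter_upwards [(isClosed_tsupport h).isOpen_compl.mem_nhds hx] with a ha
  exact image_eq_zero_of_notMem_tsupport ha

theorem IsElementary.elem_mono {V V' : Set E} (hV : E.IsElementary V) (h : V' ⊆ V) {g : Cc 𝔽 n M}
    (hg : tsupport (g : M → 𝔽) ⊆ E.proj '' V') : E.elem V' g = E.elem V g := by
  refine Sec.ext fun z => ?_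
  by_cases hz : z ∈ V'
  · rw [elem_of_mem _ hz, elem_of_mem _ (h hz)]
  · rw [elem_of_notMem _ hz]
    by_cases hzV : z ∈ V
    · rw [elem_of_mem _ hzV, coe_comp_eq rfl (eventually_zero (h := (g : M → 𝔽)) (x := E.proj z) ?_)]
      · rfl
      · intro hc
        obtain ⟨a, ha, haz⟩ := hg hc
        exact hz (hV.2 (h ha) hzV haz ▸ ha)
    · rw [elem_of_notMem _ hzV]

theorem elem_zero (V : Set E) : E.elem V (0 : Cc 𝔽 n M) = 0 := by
  refine Sec.ext fun z => ?_
  by_cases hz : z ∈ V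
  · rw [elem_of_mem _ hz]; rfl
  · rw [elem_of_notMem _ hz]; rfl

variable [T2Space M] [IsManifold (𝓡 n) ∞ M]

theorem tsupport_mul_subset_left (k h : Cc 𝔽 n M) : tsupport ((k * h : Cc 𝔽 n M) : M → 𝔽) ⊆ tsupport (k : M → 𝔽) :=
  closure_mono fun x hx hx0 => hx (by change (k : M → 𝔽) x * _ = 0; rw [hx0, zero_mul])
theorem tsupport_mul_subset_right (k h : Cc 𝔽 n M) : tsupport ((k * h : Cc 𝔽 n M) : M → 𝔽) ⊆ tsupport (h : M → 𝔽) :=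
  mul_comm k h ▸ tsupport_mul_subset_left h k

/-- The extension by zero of `h ∘ π|_U`, as an element of `E.cc 𝔽`. -/
def IsElementary.mk {U : Set E} (hU : E.IsElementary U) (h : Cc 𝔽 n M)
    (hh : tsupport (h : M → 𝔽) ⊆ E.proj '' U) : E.cc 𝔽 := ⟨E.elem U h, hU.elem_mem hh⟩

theorem cc_eq_top (𝓑 : Set (Set E)) (h𝓑 : ∀ V ∈ 𝓑, E.IsElementary V) (hcov : ∀ y : E, ∃ V ∈ 𝓑, y ∈ V)
    (T : AddSubgroup (E.cc 𝔽))
    (hT : ∀ V (hV : V ∈ 𝓑) (h : Cc 𝔽 n M) (hh : tsupport (h : M → 𝔽) ⊆ E.proj '' V), (h𝓑 V hV).mk h hh ∈ T)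
    (u : E.cc 𝔽) : u ∈ T := by
  have := cc_induction 𝓑 h𝓑 hcov (T.map (E.cc 𝔽).subtype.toAddMonoidHom)
    (fun V hV h hh => ⟨_, hT V hV h hh, rfl⟩) u.2
  obtain ⟨v, hv, hvu⟩ := this
  exact (Subtype.ext hvu : v = u) ▸ hv

theorem cc_eq_top' (T : AddSubgroup (E.cc 𝔽))
    (hT : ∀ V (hV : E.IsElementary V) (h : Cc 𝔽 n M) (hh : tsupport (h : M → 𝔽) ⊆ E.proj '' V), hV.mk h hh ∈ T)
    (u : E.cc 𝔽) : u ∈ T :=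
  cc_eq_top {V | E.IsElementary V} (fun _ h => h) exists_isElementary T hT u

theorem cc_locallyUnitary : LocallyUnitary (Cc 𝔽 n M) (E.cc 𝔽) := by
  refine locallyUnitary_of_forall fun u => cc_eq_top'
    { carrier := {u : E.cc 𝔽 | ∃ r : Cc 𝔽 n M, r ⋆ u = u}
      add_mem' := fun ha hb => lu_add ha hb
      zero_mem' := ⟨0, smul_zero _⟩
      neg_mem' := fun ⟨r, hr⟩ => ⟨r, by rw [smul_neg, hr]⟩ } (fun V hV h hh => ?_) u
  obtain ⟨r, hr, -⟩ := Cc.exists_eq_one (𝔽 := 𝔽) (n := n) h.2.2.isCompact isOpen_univ (Set.subset_univ _)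
  refine ⟨r, Subtype.ext ?_⟩
  refine (star_elem V r h).trans ?_
  congr 1
  ext y
  change (r : M → 𝔽) y * (h : M → 𝔽) y = (h : M → 𝔽) y
  by_cases hy : y ∈ tsupport (h : M → 𝔽)
  · rw [(hr y hy).eq_of_nhds]; exact one_mul _
  · rw [image_eq_zero_of_notMem_tsupport hy, mul_zero]

/-- Data for an element of `E.cc 𝔽` with germ `1` at `y` and germ `0` at the other points of the fibre. -/
structure LocalUnit (𝔽 : Type) [RCLike 𝔽] (y : E) where
  /-- an elementary set -/
  U : Set E
  elementary : E.IsElementary U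
  mem : y ∈ U
  /-- a function on `M` -/
  h : Cc 𝔽 n M
  supp : tsupport (h : M → 𝔽) ⊆ E.proj '' U
  germ_eq : Cc.germ (E.proj y) h = 1

theorem exists_localUnit {V : Set E} (hV : E.IsElementary V) {y : E} (hy : y ∈ V) :
    ∃ s : LocalUnit 𝔽 y, s.U = V := by
  obtain ⟨b, hb, hbs⟩ := Cc.exists_bump (𝔽 := 𝔽) (n := n) (E.proj y)
    ((E.isOpenMap_proj _ hV.1).mem_nhds ⟨y, hy, rfl⟩)
  exact ⟨⟨V, hV, hy, b, hbs, Cc.germ_eq_one.2 hb⟩, rfl⟩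

instance (y : E) : Nonempty (LocalUnit 𝔽 y) := by
  obtain ⟨V, hV, hy⟩ := exists_isElementary y
  obtain ⟨s, -⟩ := exists_localUnit (𝔽 := 𝔽) hV hy
  exact ⟨s⟩

/-- The corresponding element of `E.cc 𝔽`. -/
def LocalUnit.sec {y : E} (s : LocalUnit 𝔽 y) : E.cc 𝔽 := s.elementary.mk s.h s.supp

theorem LocalUnit.sec_self {y : E} (s : LocalUnit 𝔽 y) : (s.sec : Sec 𝔽 E.proj) y = 1 := by
  refine (elem_of_mem _ s.mem).trans ?_
  rw [coe_comp_eq rfl (Cc.germ_eq_one.1 s.germ_eq)]; rfl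

theorem LocalUnit.sec_ne {y z : E} (s : LocalUnit 𝔽 y) (hzy : E.proj z = E.proj y) (h : z ≠ y) :
    (s.sec : Sec 𝔽 E.proj) z = 0 :=
  elem_of_notMem _ fun hz => h (s.elementary.2 hz s.mem hzy)

theorem mk_mem_Nx {V : Set E} (hV : E.IsElementary V) (h : Cc 𝔽 n M)
    (hh : tsupport (h : M → 𝔽) ⊆ E.proj '' V) {x : M} (hx : x ∉ E.proj '' V) :
    hV.mk h hh ∈ Nx 𝔽 n (E.cc 𝔽) x ∧ ∃ k : Cc 𝔽 n M, Cc.germ x k = 1 ∧ k * h = 0 := by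
  obtain ⟨k, hk, hkh⟩ := exists_mul_eq_zero (x := x) (a := Plus.of h)
    ((toGerm_of x h).trans (Cc.germ_eq_zero.2 (eventually_zero fun hc => hx (hh hc))))
  rw [← Plus.of_mul] at hkh
  have hkh : k * h = 0 := congrArg Plus.part hkh
  refine ⟨⟨k, hk, Subtype.ext ?_⟩, k, hk, hkh⟩
  refine (star_elem V k h).trans ?_
  rw [hkh]; exact elem_zero V

theorem exists_star_mk_eq {V : Set E} (hV : E.IsElementary V) (h : Cc 𝔽 n M)
    (hh : tsupport (h : M → 𝔽) ⊆ E.proj '' V) {y : E} (hy : y ∈ V) (s : LocalUnit 𝔽 y) :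
    ∃ k : Cc 𝔽 n M, Cc.germ (E.proj y) k = 1 ∧ k ⋆ hV.mk h hh = k ⋆ h ⋆ s.sec := by
  obtain ⟨k, hk, hks⟩ := Cc.exists_bump (𝔽 := 𝔽) (n := n) (E.proj y)
    ((E.isOpenMap_proj _ (hV.1.inter s.elementary.1)).mem_nhds ⟨y, ⟨hy, s.mem⟩, rfl⟩)
  obtain ⟨k', hk', hkk⟩ := exists_mul_eq s.germ_eq
  refine ⟨k * k', by rw [map_mul, hk', mul_one]; exact Cc.germ_eq_one.2 hk, Subtype.ext ?_⟩
  refine (star_elem V (k * k') h).trans (Eq.trans ?_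
    ((congrArg Subtype.val (star_star (k * k') h s.sec)).trans (star_elem s.U (k * k' * h) s.h)).symm)
  have e : k * k' * h * s.h = k * k' * h := by
    rw [mul_right_comm, mul_assoc k, hkk]
  have hs : tsupport ((k * k' * h : Cc 𝔽 n M) : M → 𝔽) ⊆ E.proj '' (V ∩ s.U) :=
    (tsupport_mul_subset_left _ _).trans ((tsupport_mul_subset_left _ _).trans hks)
  rw [e, ← hV.elem_mono Set.inter_subset_left hs, ← s.elementary.elem_mono Set.inter_subset_right hs]

theorem span_localUnit_sup (x : M) (s : ∀ y : E.proj ⁻¹' {x}, LocalUnit 𝔽 (y : E)) (u : E.cc 𝔽) :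
    u ∈ Submodule.span (Plus (Cc 𝔽 n M)) (Set.range fun y => (s y).sec) ⊔ Nx 𝔽 n (E.cc 𝔽) x := by
  refine cc_eq_top' (Submodule.span (Plus (Cc 𝔽 n M)) (Set.range fun y => (s y).sec) ⊔ Nx 𝔽 n (E.cc 𝔽) x).toAddSubgroup
    (fun V hV h hh => ?_) u
  change hV.mk h hh ∈ (_ ⊔ _ : Submodule (Plus (Cc 𝔽 n M)) (E.cc 𝔽))
  by_cases hx : x ∈ E.proj '' V
  · obtain ⟨y, hy, rfl⟩ := hx
    obtain ⟨k, hk, e⟩ := exists_star_mk_eq hV h hh hy (s ⟨y, rfl⟩)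
    rw [← sub_add_cancel (hV.mk h hh) (h ⋆ (s ⟨y, rfl⟩).sec)]
    refine add_mem (Submodule.mem_sup_right ⟨k, hk, by rw [smul_sub, e, sub_self]⟩)
      (Submodule.mem_sup_left (Submodule.smul_mem _ _ (Submodule.subset_span ⟨_, rfl⟩)))
  · exact Submodule.mem_sup_right (mk_mem_Nx hV h hh hx).1

end elem
end ManifoldSheaf

variable [T2Space M] [IsManifold (𝓡 n) ∞ M]

theorem Sec.eq_zero_of_mem_Nx {X : Type*} [TopologicalSpace X] {p : X → M} (hp : Continuous p) {u : Sec 𝔽 p} {y : X}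
    (hu : u ∈ Nx 𝔽 n (Sec 𝔽 p) (p y)) : u y = 0 := by
  obtain ⟨f, hf, hfu⟩ := hu
  have h1 := Sec.star_apply (p := p) f u y
  have h2 : (((f : M → 𝔽) ∘ p : X → 𝔽) : (𝓝 y).Germ 𝔽) = 1 :=
    Germ.coe_eq.2 (hp.continuousAt.eventually (Cc.germ_eq_one.1 hf))
  rw [hfu, h2, one_mul] at h1
  exact h1.symm

theorem mem_Nx_of_dual {A : Type*} [AddCommGroup A] [Module (Plus (Cc 𝔽 n M)) A] {X : Type*} [TopologicalSpace X]
    {p : X → M} (hp : Continuous p) (hp' : ∀ y, 𝓝 (p y) ≤ map p (𝓝 y))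
    (ev : A →ₗ[Plus (Cc 𝔽 n M)] Sec 𝔽 p) {x : M} {ι : Type*} (s : ι → A) (y : ι → X) (hy : ∀ i, p (y i) = x)
    (h1 : ∀ i, ev (s i) (y i) = 1) (h0 : ∀ i j, i ≠ j → ev (s i) (y j) = 0) {t : A}
    (ht : t ∈ Submodule.span (Plus (Cc 𝔽 n M)) (Set.range s) ⊔ Nx 𝔽 n A x)
    (hev : ∀ i, ev t (y i) = 0) : t ∈ Nx 𝔽 n A x := by
  classical
  obtain ⟨t', ht', r, hr, rfl⟩ := Submodule.mem_sup.1 ht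
  obtain ⟨a, rfl⟩ := Finsupp.mem_span_range_iff_exists_finsupp.1 ht'
  refine add_mem (sum_mem fun i hi => ?_) hr
  refine smul_mem_Nx ?_ _
  have h2 := hev i
  rw [map_add, Sec.add_apply, Sec.eq_zero_of_mem_Nx hp (u := ev r) (y := y i) (by rw [hy]; exact Nx_map ev hr),
    add_zero, Finsupp.sum, map_sum] at h2
  have h3 : ∀ (S : Finset ι) (g : ι → Sec 𝔽 p) (z : X), (∑ j ∈ S, g j) z = ∑ j ∈ S, g j z := fun S g z =>
    Finset.sum_apply (M := fun z : X => (𝓝 z).Germ 𝔽) z S g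
  rw [h3, Finset.sum_eq_single i] at h2
  · rw [map_smul] at h2
    have := Sec.toGerm_eq_zero (hp' (y i)) (h1 i) h2
    rwa [hy] at this
  · intro j _ hj
    rw [map_smul, Sec.smul_apply, h0 j i hj, mul_zero]
  · intro hc; exact absurd hi hc

namespace ManifoldSheaf
theorem Omega_injective (E : ManifoldSheaf.{u, w} n M) (F : ManifoldSheaf.{u, w₂} n M) :
    Function.Injective (Omega 𝔽 E F) := by
  rw [injective_iff_map_eq_zero]
  intro t ht
  refine eq_zero_of_forall_mem_Nx cc_locallyUnitary.tensor fun x => ?_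
  let s : ∀ y : E.proj ⁻¹' {x}, LocalUnit 𝔽 (y : E) := fun y => Classical.arbitrary _
  let s' : ∀ y : F.proj ⁻¹' {x}, LocalUnit 𝔽 (y : F) := fun y => Classical.arbitrary _
  have hfib : ∀ i : (E.proj ⁻¹' {x}) × (F.proj ⁻¹' {x}), E.proj (i.1 : E) = F.proj (i.2 : F) :=
    fun i => Eq.trans i.1.2 (Eq.symm i.2.2)
  refine mem_Nx_of_dual (continuous_fibProj E F) (nhds_le_fibProj E F) (Omega 𝔽 E F)
    (ι := (E.proj ⁻¹' {x}) × (F.proj ⁻¹' {x})) (fun i => (s i.1).sec ⊗ₜ (s' i.2).sec)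
    (fun i => FibreProduct.mk (i.1 : E) (i.2 : F) (hfib i)) (fun i => i.1.2) ?_ ?_ ?_ ?_
  · rintro ⟨y, z⟩
    exact boxProd_eq_one (s y).sec_self (s' z).sec_self
  · rintro ⟨y, z⟩ ⟨y', z'⟩ hne
    by_cases hy : y' = y
    · have hz : z' ≠ z := fun h => hne (by rw [hy, h])
      exact boxProd_eq_zero_right
        ((s' z).sec_ne (z := (z' : F)) (z'.2.trans z.2.symm) (fun h => hz (Subtype.ext h)))
    · exact boxProd_eq_zero_left
        ((s y).sec_ne (z := (y' : E)) (y'.2.trans y.2.symm) (fun h => hy (Subtype.ext h)))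
  · have hr : (Set.range fun i : (E.proj ⁻¹' {x}) × (F.proj ⁻¹' {x}) => (s i.1).sec ⊗ₜ[Plus (Cc 𝔽 n M)] (s' i.2).sec)
        = Set.image2 (fun a b => TensorProduct.mk (Plus (Cc 𝔽 n M)) _ _ a b) (Set.range fun y => (s y).sec) (Set.range fun y => (s' y).sec) := by
      rw [Set.image2_range]; rfl
    rw [hr, ← Submodule.map₂_span_span]
    clear ht
    induction t using TensorProduct.induction_on with
    | zero => exact zero_mem _
    | tmul u v =>
      obtain ⟨u', hu', u'', hu'', rfl⟩ := Submodule.mem_sup.1 (span_localUnit_sup x s u)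
      obtain ⟨v', hv', v'', hv'', rfl⟩ := Submodule.mem_sup.1 (span_localUnit_sup x s' v)
      rw [TensorProduct.add_tmul, TensorProduct.tmul_add, add_assoc]
      refine add_mem (Submodule.mem_sup_left (Submodule.apply_mem_map₂ _ hu' hv')) (Submodule.mem_sup_right (add_mem ?_ ?_))
      · exact Nx_map (D := E.cc 𝔽 ⊗[Plus (Cc 𝔽 n M)] F.cc 𝔽) (TensorProduct.mk (Plus (Cc 𝔽 n M)) (E.cc 𝔽) (F.cc 𝔽) u') hv''
      · exact Nx_map (D := E.cc 𝔽 ⊗[Plus (Cc 𝔽 n M)] F.cc 𝔽) ((TensorProduct.mk (Plus (Cc 𝔽 n M)) (E.cc 𝔽) (F.cc 𝔽)).flip (v' + v'')) hu''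
    | add a b ha hb => exact add_mem ha hb
  · intro i
    rw [ht]; rfl
end ManifoldSheaf

end
end SheafCoalg

namespace SheafCoalg
noncomputable section
variable {𝔽 : Type} [RCLike 𝔽] {n : ℕ} {M : Type u} [TopologicalSpace M] [ChartedSpace (EuclideanSpace ℝ (Fin n)) M]

namespace ManifoldSheaf
variable {E : ManifoldSheaf.{u, w} n M}

open Classical in
/-- The push-forward of `u` along the diagonal `E → E ×_M E` (a local diffeomorphism): its germ is that of `u`
at the points of the diagonal, and zero elsewhere. -/
def diagFun (u : Sec 𝔽 E.proj) : Sec 𝔽 (fibProj E E) := fun p =>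
  if pr₁ E E p = pr₂ E E p then pullGerm (pr₁ E E) (continuous_pr₁ E E) p (u (pr₁ E E p)) else 0

theorem diagFun_of_eq (u : Sec 𝔽 E.proj) {p : FibreProduct E E} (h : pr₁ E E p = pr₂ E E p) :
    diagFun u p = pullGerm (pr₁ E E) (continuous_pr₁ E E) p (u (pr₁ E E p)) := if_pos h
theorem diagFun_of_ne (u : Sec 𝔽 E.proj) {p : FibreProduct E E} (h : pr₁ E E p ≠ pr₂ E E p) :
    diagFun u p = 0 := if_neg h

variable (𝔽 E) in
/-- The push-forward along the diagonal, as a linear map. -/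
def diag : Sec 𝔽 E.proj →ₗ[Plus (Cc 𝔽 n M)] Sec 𝔽 (fibProj E E) where
  toFun := diagFun
  map_add' u v := Sec.ext fun p => by
    rw [Sec.add_apply]
    by_cases h : pr₁ E E p = pr₂ E E p
    · rw [diagFun_of_eq _ h, diagFun_of_eq _ h, diagFun_of_eq _ h, ← pullGerm_add]; rfl
    · rw [diagFun_of_ne _ h, diagFun_of_ne _ h, diagFun_of_ne _ h, add_zero]
  map_smul' a u := Sec.ext fun p => by
    rw [RingHom.id_apply, Sec.smul_apply]
    by_cases h : pr₁ E E p = pr₂ E E p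
    · rw [diagFun_of_eq _ h, diagFun_of_eq _ h, Sec.smul_apply, pullGerm_mul]; rfl
    · rw [diagFun_of_ne _ h, diagFun_of_ne _ h, mul_zero]

variable [T2Space M] [IsManifold (𝓡 n) ∞ M]

theorem mul_eq_self {h η : Cc 𝔽 n M} (hη : ∀ x ∈ tsupport (h : M → 𝔽), (η : M → 𝔽) =ᶠ[𝓝 x] 1) : η * h = h := by
  ext y
  change (η : M → 𝔽) y * (h : M → 𝔽) y = (h : M → 𝔽) y
  by_cases hy : y ∈ tsupport (h : M → 𝔽)
  · rw [(hη y hy).eq_of_nhds]; exact one_mul _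
  · rw [image_eq_zero_of_notMem_tsupport hy, mul_zero]

theorem IsElementary.exists_mul_eq_self {V : Set E} (hV : E.IsElementary V) {h : Cc 𝔽 n M}
    (hh : tsupport (h : M → 𝔽) ⊆ E.proj '' V) :
    ∃ η : Cc 𝔽 n M, tsupport (η : M → 𝔽) ⊆ E.proj '' V ∧ η * h = h := by
  obtain ⟨η, h1, h2⟩ := Cc.exists_eq_one (𝔽 := 𝔽) (n := n) h.2.2.isCompact (E.isOpenMap_proj _ hV.1) hh
  exact ⟨η, h2, mul_eq_self h1⟩

theorem diag_elem {V : Set E} (hV : E.IsElementary V) {h η : Cc 𝔽 n M} (hη : η * h = h) :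
    diag 𝔽 E (E.elem V h) = boxProd (E.elem V h) (E.elem V η) := by
  refine Sec.ext fun p => ?_
  change diagFun _ p = _
  by_cases hp : pr₁ E E p = pr₂ E E p
  · rw [diagFun_of_eq _ hp]
    by_cases h1 : pr₁ E E p ∈ V
    · rw [boxProd_apply, elem_of_mem _ h1, elem_of_mem _ (hp ▸ h1), pullGerm_coe, pullGerm_coe]
      refine congrArg _ (funext fun q => ?_)
      change (h : M → 𝔽) (E.proj (pr₁ E E q)) = (h : M → 𝔽) (E.proj (pr₁ E E q)) * (η : M → 𝔽) (E.proj (pr₂ E E q))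
      rw [← fibProj_eq E E q]
      change (h : M → 𝔽) (fibProj E E q) = (h : M → 𝔽) (fibProj E E q) * (η : M → 𝔽) (fibProj E E q)
      conv_lhs => rw [← hη]
      exact mul_comm _ _
    · rw [boxProd_eq_zero_left (elem_of_notMem _ h1), elem_of_notMem _ h1]; rfl
  · rw [diagFun_of_ne _ hp]
    by_cases h1 : pr₁ E E p ∈ V
    · have h2 : pr₂ E E p ∉ V := fun h2 => hp (hV.2 h1 h2 p.2)
      rw [boxProd_eq_zero_right (elem_of_notMem _ h2)]
    · rw [boxProd_eq_zero_left (elem_of_notMem _ h1)]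

theorem diag_mem_range (u : E.cc 𝔽) : diag 𝔽 E u ∈ LinearMap.range (Omega 𝔽 E E) := by
  refine cc_eq_top' ((LinearMap.range (Omega 𝔽 E E)).comap (diag 𝔽 E ∘ₗ (E.cc 𝔽).subtype)).toAddSubgroup
    (fun V hV h hh => ?_) u
  obtain ⟨η, hη, e⟩ := hV.exists_mul_eq_self hh
  exact ⟨hV.mk h hh ⊗ₜ hV.mk η hη, (diag_elem hV e).symm⟩

variable (𝔽 E) in
/-- The comultiplication `Ω⁻¹ ∘ diag_+`. -/
def comul : E.cc 𝔽 →ₗ[Plus (Cc 𝔽 n M)] E.cc 𝔽 ⊗[Plus (Cc 𝔽 n M)] E.cc 𝔽 :=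
  (LinearEquiv.ofInjective (Omega 𝔽 E E) (Omega_injective E E)).symm ∘ₗ
    (diag 𝔽 E ∘ₗ (E.cc 𝔽).subtype).codRestrict (LinearMap.range (Omega 𝔽 E E)) diag_mem_range

theorem Omega_comul (u : E.cc 𝔽) : Omega 𝔽 E E (comul 𝔽 E u) = diag 𝔽 E u :=
  congrArg Subtype.val ((LinearEquiv.ofInjective (Omega 𝔽 E E) (Omega_injective E E)).apply_symm_apply
    ⟨diag 𝔽 E u, diag_mem_range u⟩)

theorem comul_mk {V : Set E} (hV : E.IsElementary V) {h η : Cc 𝔽 n M} (hh : tsupport (h : M → 𝔽) ⊆ E.proj '' V)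
    (hη : tsupport (η : M → 𝔽) ⊆ E.proj '' V) (e : η * h = h) :
    comul 𝔽 E (hV.mk h hh) = hV.mk h hh ⊗ₜ hV.mk η hη :=
  Omega_injective E E ((Omega_comul _).trans (diag_elem hV e))

/-- The push-forward of `u` along `π`: its value at `x` is the sum of the values of `u` over the fibre. -/
def counitFun (u : Sec 𝔽 E.proj) : M → 𝔽 := fun x => ∑ᶠ y : E.proj ⁻¹' {x}, Germ.value (u y)

theorem value_elem_of_mem {V : Set E} (h : Cc 𝔽 n M) {y : E} (hy : y ∈ V) :
    Germ.value (E.elem V h y) = (h : M → 𝔽) (E.proj y) := by rw [elem_of_mem _ hy]; rfl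
theorem value_elem_of_notMem {V : Set E} (h : Cc 𝔽 n M) {y : E} (hy : y ∉ V) :
    Germ.value (E.elem V h y) = 0 := by rw [elem_of_notMem _ hy]; rfl

theorem counit_elem {V : Set E} (hV : E.IsElementary V) {h : Cc 𝔽 n M} (hh : tsupport (h : M → 𝔽) ⊆ E.proj '' V) :
    (∀ x : M, (Function.support fun y : E.proj ⁻¹' {x} => Germ.value (E.elem V h y)).Finite) ∧
    counitFun (E.elem V h) = h := by
  have key : ∀ x : M, (∃ y : E.proj ⁻¹' {x}, (y : E) ∈ V ∧ ∀ z : E.proj ⁻¹' {x}, z ≠ y → Germ.value (E.elem V h z) = 0) ∨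
      ((h : M → 𝔽) x = 0 ∧ ∀ z : E.proj ⁻¹' {x}, Germ.value (E.elem V h z) = 0) := by
    intro x
    by_cases hx : x ∈ E.proj '' V
    · obtain ⟨y, hy, rfl⟩ := hx
      refine Or.inl ⟨⟨y, rfl⟩, hy, fun z hz => value_elem_of_notMem _ fun hzV => hz (Subtype.ext ?_)⟩
      exact hV.2 hzV hy z.2
    · exact Or.inr ⟨image_eq_zero_of_notMem_tsupport fun hc => hx (hh hc),
        fun z => value_elem_of_notMem _ fun hzV => hx ⟨z, hzV, z.2⟩⟩
  refine ⟨fun x => ?_, funext fun x => ?_⟩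
  · rcases key x with ⟨y, -, h1⟩ | ⟨-, h1⟩
    · exact (Set.finite_singleton y).subset fun z hz => by_contra fun hzy => hz (h1 z hzy)
    · exact Set.finite_empty.subset fun z hz => hz (h1 z)
  · rcases key x with ⟨y, hy, h1⟩ | ⟨h0, h1⟩
    · refine (finsum_eq_single _ y h1).trans ((value_elem_of_mem h hy).trans (congrArg _ y.2))
    · exact (finsum_eq_zero_of_forall_eq_zero h1).trans h0.symm

theorem counit_aux (u : E.cc 𝔽) : (∀ x : M, (Function.support fun y : E.proj ⁻¹' {x} => Germ.value ((u : Sec 𝔽 E.proj) y)).Finite) ∧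
    counitFun (u : Sec 𝔽 E.proj) ∈ Cc 𝔽 n M := by
  have hadd : ∀ (u v : Sec 𝔽 E.proj) (y : E), Germ.value ((u + v) y) = Germ.value (u y) + Germ.value (v y) :=
    fun u v y => map_add Germ.valueAddHom (u y) (v y)
  have hneg : ∀ (u : Sec 𝔽 E.proj) (y : E), Germ.value ((-u) y) = - Germ.value (u y) :=
    fun u y => map_neg Germ.valueAddHom (u y)
  refine cc_eq_top'
    { carrier := {u : E.cc 𝔽 | (∀ x : M, (Function.support fun y : E.proj ⁻¹' {x} => Germ.value ((u : Sec 𝔽 E.proj) y)).Finite) ∧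
        counitFun (u : Sec 𝔽 E.proj) ∈ Cc 𝔽 n M}
      add_mem' := ?_
      zero_mem' := ?_
      neg_mem' := ?_ } (fun V hV h hh => ?_) u
  · intro u v hu hv
    refine ⟨fun x => ((hu.1 x).union (hv.1 x)).subset fun y hy => ?_, ?_⟩
    · by_contra hc
      simp only [Set.mem_union, Function.mem_support, not_or, not_not] at hc
      refine hy ((hadd u v y).trans ?_)
      rw [hc.1, hc.2, add_zero]
    · have : counitFun ((u + v : E.cc 𝔽) : Sec 𝔽 E.proj) = counitFun (u : Sec 𝔽 E.proj) + counitFun (v : Sec 𝔽 E.proj) :=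
        funext fun x => (finsum_congr fun y : E.proj ⁻¹' {x} => hadd u v (y : E)).trans (finsum_add_distrib (hu.1 x) (hv.1 x))
      rw [this]
      exact add_mem hu.2 hv.2
  · have h0 : ∀ x (y : E.proj ⁻¹' {x}), Germ.value (((0 : E.cc 𝔽) : Sec 𝔽 E.proj) y) = 0 := fun x y => map_zero (Germ.valueAddHom (x := (y : E)) (E := 𝔽))
    refine ⟨fun x => Set.finite_empty.subset fun y hy => hy (h0 x y), ?_⟩
    have : counitFun ((0 : E.cc 𝔽) : Sec 𝔽 E.proj) = 0 := funext fun x => finsum_eq_zero_of_forall_eq_zero (h0 x)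
    rw [this]
    exact zero_mem _
  · intro u hu
    refine ⟨fun x => (hu.1 x).subset fun y hy hc => hy ((hneg u y).trans ((congrArg (- ·) hc).trans neg_zero)), ?_⟩
    · have : counitFun ((-u : E.cc 𝔽) : Sec 𝔽 E.proj) = - counitFun (u : Sec 𝔽 E.proj) :=
        funext fun x => (finsum_congr fun y : E.proj ⁻¹' {x} => hneg u (y : E)).trans (finsum_neg_distrib _)
      rw [this]
      exact neg_mem hu.2
  · obtain ⟨h1, h2⟩ := counit_elem hV hh
    refine ⟨h1, ?_⟩
    change counitFun (E.elem V h) ∈ _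
    rw [h2]
    exact h.2

variable (𝔽 E) in
/-- The counit `π_+`. -/
def counit : E.cc 𝔽 →ₗ[Plus (Cc 𝔽 n M)] Cc 𝔽 n M where
  toFun u := ⟨counitFun (u : Sec 𝔽 E.proj), (counit_aux u).2⟩
  map_add' u v := Subtype.ext <| funext fun x => by
    refine (finsum_congr fun y => ?_).trans (finsum_add_distrib ((counit_aux u).1 x) ((counit_aux v).1 x))
    exact map_add Germ.valueAddHom ((u : Sec 𝔽 E.proj) y) ((v : Sec 𝔽 E.proj) y)
  map_smul' a u := Subtype.ext <| funext fun x => by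
    have h1 : counitFun ((a • u : E.cc 𝔽) : Sec 𝔽 E.proj) x
        = ((a.int : 𝔽) + (a.part : M → 𝔽) x) * counitFun (u : Sec 𝔽 E.proj) x := by
      refine (finsum_congr fun y => ?_).trans (mul_finsum' _ _ ((counit_aux u).1 x)).symm
      rw [Submodule.coe_smul, Sec.smul_apply]
      refine (map_mul Germ.valueMulHom _ _).trans ?_
      refine congrArg₂ (· * ·) ?_ rfl
      change (a.int : 𝔽) + (a.part : M → 𝔽) (E.proj y) = _
      rw [show E.proj y = x from y.2]
    refine h1.trans ?_
    rw [RingHom.id_apply, smul_def, add_mul]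
    change _ = a.int • counitFun (u : Sec 𝔽 E.proj) x + (a.part : M → 𝔽) x * counitFun (u : Sec 𝔽 E.proj) x
    rw [zsmul_eq_mul]

theorem counit_mk {V : Set E} (hV : E.IsElementary V) {h : Cc 𝔽 n M} (hh : tsupport (h : M → 𝔽) ⊆ E.proj '' V) :
    counit 𝔽 E (hV.mk h hh) = h := Subtype.ext (counit_elem hV hh).2

theorem star_mk {V : Set E} (hV : E.IsElementary V) {h : Cc 𝔽 n M} (hh : tsupport (h : M → 𝔽) ⊆ E.proj '' V)
    {k g : Cc 𝔽 n M} (hg : tsupport (g : M → 𝔽) ⊆ E.proj '' V) (e : k * h = g) : k ⋆ hV.mk h hh = hV.mk g hg :=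
  Subtype.ext ((star_elem V k h).trans (by rw [e]; rfl))

/-- The sheaf coalgebra of `E`. -/
instance coalgebra (E : ManifoldSheaf.{u, w} n M) : NUCoalgebra (Cc 𝔽 n M) (E.cc 𝔽) where
  locallyUnitary := cc_locallyUnitary
  comul := comul 𝔽 E
  counit := counit 𝔽 E
  id_tensor_counit u := cc_eq_top' (LinearMap.eqLocus (TensorProduct.lift act ∘ₗ (counit 𝔽 E).lTensor (E.cc 𝔽) ∘ₗ comul 𝔽 E)
      LinearMap.id).toAddSubgroup (fun V hV h hh => by
    obtain ⟨η, hη, e⟩ := hV.exists_mul_eq_self hh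
    change TensorProduct.lift act ((counit 𝔽 E).lTensor (E.cc 𝔽) (comul 𝔽 E (hV.mk h hh))) = hV.mk h hh
    rw [comul_mk hV hh hη e, LinearMap.lTensor_tmul, TensorProduct.lift.tmul, act_apply, counit_mk,
      star_mk hV hh hh e]) u
  counit_tensor_id u := cc_eq_top' (LinearMap.eqLocus (TensorProduct.lift act.flip ∘ₗ (counit 𝔽 E).rTensor (E.cc 𝔽) ∘ₗ comul 𝔽 E)
      LinearMap.id).toAddSubgroup (fun V hV h hh => by
    obtain ⟨η, hη, e⟩ := hV.exists_mul_eq_self hh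
    change TensorProduct.lift act.flip ((counit 𝔽 E).rTensor (E.cc 𝔽) (comul 𝔽 E (hV.mk h hh))) = hV.mk h hh
    rw [comul_mk hV hh hη e, LinearMap.rTensor_tmul, TensorProduct.lift.tmul, LinearMap.flip_apply, act_apply, counit_mk,
      star_mk hV hη hh ((mul_comm h η).trans e)]) u
end ManifoldSheaf

end
end SheafCoalg

namespace SheafCoalg
noncomputable section
section PullCharts
variable {n : ℕ} {M : Type u} [TopologicalSpace M] [ChartedSpace (EuclideanSpace ℝ (Fin n)) M]
variable {X : Type w} [TopologicalSpace X] {p : X → M} (φ : X → OpenPartialHomeomorph X M)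
  (hφ : ∀ e, e ∈ (φ e).source) (hp : ∀ e y, φ e y = p y)

/-- The smooth structure for which the local homeomorphism `p` is a local diffeomorphism. -/
@[reducible] def pullCharts : ChartedSpace (EuclideanSpace ℝ (Fin n)) X where
  atlas := Set.range fun e => (φ e).trans (chartAt (EuclideanSpace ℝ (Fin n)) (p e))
  chartAt e := (φ e).trans (chartAt (EuclideanSpace ℝ (Fin n)) (p e))
  mem_chart_source e := by
    rw [OpenPartialHomeomorph.trans_source]
    exact ⟨hφ e, by rw [Set.mem_preimage, hp]; exact mem_chart_source _ _⟩
  chart_mem_atlas e := ⟨e, rfl⟩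

variable [IsManifold (𝓡 n) ∞ M]

theorem pullCharts_isManifold : @IsManifold _ _ _ _ _ _ _ (𝓡 n) ∞ X _ (pullCharts (n := n) φ hφ hp) := by
  letI := pullCharts (n := n) φ hφ hp
  refine isManifold_of_contDiffOn _ _ _ ?_
  rintro _ _ ⟨e, rfl⟩ ⟨e', rfl⟩
  have h := ((contDiffGroupoid ∞ (𝓡 n)).compatible (chart_mem_atlas (EuclideanSpace ℝ (Fin n)) (p e))
    (chart_mem_atlas (EuclideanSpace ℝ (Fin n)) (p e'))).1
  have key : ∀ z ∈ (((φ e).trans (chartAt (EuclideanSpace ℝ (Fin n)) (p e))).symm.trans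
      ((φ e').trans (chartAt (EuclideanSpace ℝ (Fin n)) (p e')))).source,
      φ e' ((φ e).symm ((chartAt (EuclideanSpace ℝ (Fin n)) (p e)).symm z)) = (chartAt (EuclideanSpace ℝ (Fin n)) (p e)).symm z := by
    intro z hz
    rw [hp, ← hp e]
    simp only [mfld_simps] at hz
    exact (φ e).right_inv hz.1.2
  refine (h.mono ?_).congr ?_
  · rintro z ⟨hz, hz'⟩
    refine ⟨?_, hz'⟩
    have h1 := key _ hz
    simp only [mfld_simps] at hz ⊢
    refine ⟨hz.1.1, ?_⟩
    have h2 := hz.2.2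
    rwa [h1] at h2
  · rintro z ⟨hz, hz'⟩
    have h1 := key _ hz
    simp only [mfld_simps] at h1 ⊢
    rw [h1]

theorem pullCharts_isLocalDiffeomorph :
    @IsLocalDiffeomorph ℝ _ _ _ _ _ _ _ _ _ _ _ (𝓡 n) (𝓡 n) X _ (pullCharts (n := n) φ hφ hp) M _ _ ∞ p := by
  letI := pullCharts (n := n) φ hφ hp
  haveI := pullCharts_isManifold (n := n) φ hφ hp
  have hchart : ∀ e : X, chartAt (EuclideanSpace ℝ (Fin n)) e = (φ e).trans (chartAt (EuclideanSpace ℝ (Fin n)) (p e)) := fun _ => rfl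
  have hopen : ∀ e : X, (chartAt (EuclideanSpace ℝ (Fin n)) e).source ∈ 𝓝 e := fun e =>
    (chartAt (EuclideanSpace ℝ (Fin n)) e).open_source.mem_nhds (mem_chart_source _ _)
  have h1 : ContMDiff (𝓡 n) (𝓡 n) ∞ p := by
    intro e
    have hz : chartAt (EuclideanSpace ℝ (Fin n)) e e ∈ (chartAt (EuclideanSpace ℝ (Fin n)) (p e)).target := by
      rw [hchart]
      have := mem_chart_source (EuclideanSpace ℝ (Fin n)) e
      rw [hchart, OpenPartialHomeomorph.trans_source] at this
      exact (chartAt (EuclideanSpace ℝ (Fin n)) (p e)).map_source this.2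
    have := ((contMDiffOn_chart_symm (I := 𝓡 n) (n := ∞) (x := p e)).contMDiffAt
      ((chartAt (EuclideanSpace ℝ (Fin n)) (p e)).open_target.mem_nhds hz)).comp e
      ((contMDiffOn_chart (I := 𝓡 n) (n := ∞) (x := e)).contMDiffAt (hopen e))
    refine this.congr_of_eventuallyEq ?_
    filter_upwards [hopen e] with y hy
    rw [hchart, OpenPartialHomeomorph.trans_source] at hy
    rw [Function.comp_apply, hchart, OpenPartialHomeomorph.trans_apply,
      (chartAt (EuclideanSpace ℝ (Fin n)) (p e)).left_inv hy.2, hp]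
  have h2 : ∀ e, ContMDiffAt (𝓡 n) (𝓡 n) ∞ (φ e).symm (p e) := by
    intro e
    have hz : chartAt (EuclideanSpace ℝ (Fin n)) (p e) (p e) ∈ (chartAt (EuclideanSpace ℝ (Fin n)) e).target := by
      have := (chartAt (EuclideanSpace ℝ (Fin n)) e).map_source (mem_chart_source (EuclideanSpace ℝ (Fin n)) e)
      rwa [hchart, OpenPartialHomeomorph.trans_apply, hp] at this
    have := ((contMDiffOn_chart_symm (I := 𝓡 n) (n := ∞) (x := e)).contMDiffAt
      ((chartAt (EuclideanSpace ℝ (Fin n)) e).open_target.mem_nhds hz)).comp (p e)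
      ((contMDiffOn_chart (I := 𝓡 n) (n := ∞) (x := p e)).contMDiffAt
        ((chartAt (EuclideanSpace ℝ (Fin n)) (p e)).open_source.mem_nhds (mem_chart_source _ _)))
    refine this.congr_of_eventuallyEq ?_
    filter_upwards [(chartAt (EuclideanSpace ℝ (Fin n)) (p e)).open_source.mem_nhds (mem_chart_source _ _)] with x hx
    rw [Function.comp_apply, hchart, OpenPartialHomeomorph.coe_trans_symm, Function.comp_apply,
      (chartAt (EuclideanSpace ℝ (Fin n)) (p e)).left_inv hx]
  intro e
  refine ⟨⟨(φ e).toPartialEquiv, (φ e).open_source, (φ e).open_target, ?_, ?_⟩, hφ e, fun y _ => (hp e y).symm⟩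
  · intro y hy
    have : ContMDiffAt (𝓡 n) (𝓡 n) ∞ (φ e) y := by
      rw [show (φ e : X → M) = p from funext (hp e)]
      exact h1 y
    exact this.contMDiffWithinAt
  · intro x hx
    have hx' := (φ e).map_target hx
    have hpx : p ((φ e).symm x) = x := by rw [← hp e]; exact (φ e).right_inv hx
    have h3 := h2 ((φ e).symm x)
    rw [hpx] at h3
    refine ContMDiffAt.contMDiffWithinAt (h3.congr_of_eventuallyEq ?_)
    have ht : x ∈ (φ ((φ e).symm x)).target := by
      have := (φ ((φ e).symm x)).map_source (hφ _)
      rwa [hp, hpx] at this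
    have hcont : ContinuousAt (φ e).symm x := (φ e).continuousAt_symm hx
    filter_upwards [hcont.eventually ((φ ((φ e).symm x)).open_source.mem_nhds (hφ _)),
      (φ e).open_target.mem_nhds hx] with z hz hz'
    have hpz : p ((φ e).symm z) = z := by rw [← hp e]; exact (φ e).right_inv hz'
    have := (φ ((φ e).symm x)).left_inv hz
    rw [hp, hpz] at this
    exact this.symm
end PullCharts

end
end SheafCoalg

namespace SheafCoalg
noncomputable section
variable (𝔽 : Type) [RCLike 𝔽] (n : ℕ) (M : Type u) [TopologicalSpace M] [ChartedSpace (EuclideanSpace ℝ (Fin n)) M]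
  [T2Space M] [IsManifold (𝓡 n) ∞ M]
  (C : Type v) [AddCommGroup C] [Module (Plus (Cc 𝔽 n M)) C] [NUCoalgebra (Cc 𝔽 n M) C]

variable {M C} in
/-- `c` is normalized at `x`. -/
def Normalized (c : C) (x : M) : Prop := Cc.germ x (NUCoalgebra.counit (R := Cc 𝔽 n M) c) = 1

variable {M C} in
/-- `c` is a weakly grouplike element, and it is normalized on the open set `W`. -/
structure IsSlice (c : C) (W : Set M) : Prop where
  weaklyGrouplike : c ∈ weaklyGrouplike 𝔽 n M C
  isOpen : IsOpen W
  normalized : ∀ x ∈ W, Normalized 𝔽 n c x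

/-- The set underlying the spectral sheaf: pairs of a point `x` and a grouplike element of `C_x`. -/
structure SpecPt : Type (max u v) where
  /-- the base point -/
  pt : M
  /-- the grouplike element -/
  germ : Loc 𝔽 n C pt
  mem : germ ∈ grouplikes 𝔽 n C pt

variable {M C} in
/-- The set `c_W` of all `c_x` with `x ∈ W` (for `c` as in `IsSlice`). -/
def germSet (c : C) (W : Set M) : Set (SpecPt 𝔽 n M C) := {y | y.pt ∈ W ∧ y.germ = locMk 𝔽 n C y.pt c}

/-- The topology generated by the sets `c_W`, for `c` weakly grouplike and normalized on `W`. -/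
instance : TopologicalSpace (SpecPt 𝔽 n M C) :=
  TopologicalSpace.generateFrom {s | ∃ (c : C) (W : Set M), IsSlice 𝔽 n c W ∧ s = germSet 𝔽 n c W}

variable {𝔽 n M C}

theorem star_mem_weaklyGrouplike (f : Cc 𝔽 n M) {c : C} (hc : c ∈ weaklyGrouplike 𝔽 n M C) : f ⋆ c ∈ weaklyGrouplike 𝔽 n M C := by
  obtain ⟨c', h⟩ := hc
  exact ⟨c', by rw [map_smul, h, TensorProduct.smul_tmul']⟩

theorem locComul_mk (x : M) (c : C) : locComul 𝔽 n C x (locMk 𝔽 n C x c) = locTensor x (NUCoalgebra.comul (R := Cc 𝔽 n M) c) := rfl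
theorem locCounit_mk (x : M) (c : C) : locCounit 𝔽 n C x (locMk 𝔽 n C x c) = Cc.germ x (NUCoalgebra.counit (R := Cc 𝔽 n M) c) := rfl

theorem weaklyGrouplike_counit {c c' : C} (h : NUCoalgebra.comul (R := Cc 𝔽 n M) c = c ⊗ₜ[Plus (Cc 𝔽 n M)] c') :
    (NUCoalgebra.counit (R := Cc 𝔽 n M) c) ⋆ c' = c := by
  have := NUCoalgebra.counit_tensor_id (R := Cc 𝔽 n M) c
  rwa [h, LinearMap.rTensor_tmul, TensorProduct.lift.tmul, LinearMap.flip_apply, act_apply] at this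

theorem mk_mem_grouplikes {c : C} (hc : c ∈ weaklyGrouplike 𝔽 n M C) {x : M} (hx : Normalized 𝔽 n c x) :
    locMk 𝔽 n C x c ∈ grouplikes 𝔽 n C x := by
  obtain ⟨c', h⟩ := hc
  refine ⟨?_, hx⟩
  have e : locMk 𝔽 n C x c' = locMk 𝔽 n C x c := by
    have h1 := germ_smul (x := x) (NUCoalgebra.counit (R := Cc 𝔽 n M) c) c'
    rwa [hx, one_smul, weaklyGrouplike_counit h] at h1
  rw [locComul_mk, h, locTensor_tmul, e]

theorem exists_weaklyGrouplike {x : M} {ζ : Loc 𝔽 n C x} (hζ : ζ ∈ grouplikes 𝔽 n C x) :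
    ∃ (c : C) (W : Set M), IsSlice 𝔽 n c W ∧ x ∈ W ∧ locMk 𝔽 n C x c = ζ := by
  obtain ⟨c, rfl⟩ := locMk_surjective x ζ
  obtain ⟨h1, h2⟩ := hζ
  have h3 : locTensor (𝔽 := 𝔽) (n := n) x (NUCoalgebra.comul (R := Cc 𝔽 n M) c - c ⊗ₜ c) = 0 := by
    rw [map_sub, sub_eq_zero]; exact h1
  obtain ⟨k, hk, hkc⟩ := locTensor_eq_zero h3
  rw [smul_sub, sub_eq_zero, ← map_smul, TensorProduct.smul_tmul'] at hkc
  have e : locMk 𝔽 n C x (k ⋆ c) = locMk 𝔽 n C x c := by rw [← germ_smul, hk, one_smul]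
  have h4 : Normalized 𝔽 n (k ⋆ c) x := by
    change locCounit 𝔽 n C x (locMk 𝔽 n C x (k ⋆ c)) = 1
    rw [e]; exact h2
  obtain ⟨W, hW, hWo, hxW⟩ := eventually_nhds_iff.1 (eventually_eventually_nhds.2 (Cc.germ_eq_one.1 h4))
  exact ⟨k ⋆ c, W, ⟨⟨c, hkc⟩, hWo, fun y hy => Cc.germ_eq_one.2 (hW y hy)⟩, hxW, e⟩

theorem isOpen_eq (c d : C) : IsOpen {x : M | locMk 𝔽 n C x c = locMk 𝔽 n C x d} := by
  refine isOpen_iff_mem_nhds.2 fun x hx => ?_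
  obtain ⟨k, hk, h⟩ := locMk_eq_iff.1 hx
  filter_upwards [eventually_eventually_nhds.2 (Cc.germ_eq_one.1 hk)] with y hy
  exact locMk_eq_iff.2 ⟨k, Cc.germ_eq_one.2 hy, h⟩

theorem isOpen_germSet {c : C} {W : Set M} (h : IsSlice 𝔽 n c W) : IsOpen (germSet 𝔽 n c W) :=
  TopologicalSpace.isOpen_generateFrom_of_mem ⟨c, W, h, rfl⟩

theorem IsSlice.mono {c : C} {W V : Set M} (h : IsSlice 𝔽 n c W) (hV : IsOpen V) (hVW : V ⊆ W) : IsSlice 𝔽 n c V :=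
  ⟨h.1, hV, fun x hx => h.3 x (hVW hx)⟩

theorem exists_slice (y : SpecPt 𝔽 n M C) : ∃ (c : C) (W : Set M), IsSlice 𝔽 n c W ∧ y ∈ germSet 𝔽 n c W := by
  obtain ⟨c, W, h, hx, e⟩ := exists_weaklyGrouplike y.mem
  exact ⟨c, W, h, hx, e.symm⟩

theorem continuous_specProj : Continuous (SpecPt.pt : SpecPt 𝔽 n M C → M) := by
  refine continuous_def.2 fun V hV => isOpen_iff_mem_nhds.2 fun y hy => ?_
  obtain ⟨c, W, h, hx⟩ := exists_slice y
  filter_upwards [(isOpen_germSet (h.mono (h.2.inter hV) Set.inter_subset_left)).mem_nhds ⟨⟨hx.1, hy⟩, hx.2⟩] with z hz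
  exact hz.1.2

theorem SpecPt.eq_of_eq {y z : SpecPt 𝔽 n M C} {c : C} (h : y.pt = z.pt) (hy : y.germ = locMk 𝔽 n C y.pt c)
    (hz : z.germ = locMk 𝔽 n C z.pt c) : y = z := by
  obtain ⟨x, a, ha⟩ := y
  obtain ⟨x', b, hb⟩ := z
  obtain rfl : x = x' := h
  obtain rfl : a = b := hy.trans hz.symm
  rfl

open Classical in
/-- The projection restricts to a homeomorphism from `c_W` to `W`. -/
def sliceHomeo {c : C} {W : Set M} (h : IsSlice 𝔽 n c W) (y₀ : SpecPt 𝔽 n M C) : OpenPartialHomeomorph (SpecPt 𝔽 n M C) M where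
  toFun := SpecPt.pt
  invFun x := if hx : x ∈ W then ⟨x, locMk 𝔽 n C x c, mk_mem_grouplikes h.1 (h.3 x hx)⟩ else y₀
  source := germSet 𝔽 n c W
  target := W
  map_source' y hy := hy.1
  map_target' x hx := by rw [dif_pos hx]; exact ⟨hx, rfl⟩
  left_inv' y hy := by rw [dif_pos hy.1]; exact SpecPt.eq_of_eq (c := c) rfl rfl hy.2
  right_inv' x hx := by rw [dif_pos hx]
  open_source := isOpen_germSet h
  open_target := h.2
  continuousOn_toFun := continuous_specProj.continuousOn
  continuousOn_invFun := by
    rw [continuousOn_iff_continuous_domRestrict]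
    refine continuous_generateFrom_iff.2 ?_
    rintro _ ⟨d, V, hd, rfl⟩
    have : (Subtype.val ⁻¹' ({x | locMk 𝔽 n C x c = locMk 𝔽 n C x d} ∩ V) : Set W) =
        W.domRestrict (fun x => if hx : x ∈ W then (⟨x, locMk 𝔽 n C x c, mk_mem_grouplikes h.1 (h.3 x hx)⟩ : SpecPt 𝔽 n M C) else y₀) ⁻¹'
          germSet 𝔽 n d V := by
      ext x
      simp only [Set.mem_preimage, Set.domRestrict_apply, dif_pos x.2]
      exact and_comm
    rw [← this]
    exact ((isOpen_eq c d).inter hd.2).preimage continuous_subtype_val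

/-- A choice of such a homeomorphism around `y`. -/
def specHomeo (y : SpecPt 𝔽 n M C) : OpenPartialHomeomorph (SpecPt 𝔽 n M C) M :=
  sliceHomeo (exists_slice y).choose_spec.choose_spec.1 y

theorem mem_specHomeo (y : SpecPt 𝔽 n M C) : y ∈ (specHomeo y).source := (exists_slice y).choose_spec.choose_spec.2

variable (𝔽 n M C) in
/-- The spectral sheaf of the coalgebra `C`. -/
def spectral : ManifoldSheaf.{u, max u v} n M where
  carrier := SpecPt 𝔽 n M C
  charts := pullCharts (n := n) specHomeo mem_specHomeo (fun _ _ => rfl)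
  manifold := pullCharts_isManifold specHomeo mem_specHomeo (fun _ _ => rfl)
  proj := SpecPt.pt
  isLocalDiffeomorph := pullCharts_isLocalDiffeomorph specHomeo mem_specHomeo (fun _ _ => rfl)

variable (𝔽 n) in
/-- The set `c_W` as a subset of the spectral sheaf. -/
def specSet (c : C) (W : Set M) : Set (spectral 𝔽 n M C) := germSet 𝔽 n c W

theorem exists_slice' (y : spectral 𝔽 n M C) : ∃ (c : C) (W : Set M), IsSlice 𝔽 n c W ∧ y ∈ specSet 𝔽 n c W :=
  exists_slice (𝔽 := 𝔽) (n := n) (M := M) (C := C) y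

theorem IsSlice.isElementary {c : C} {W : Set M} (h : IsSlice 𝔽 n c W) :
    (spectral 𝔽 n M C).IsElementary (specSet 𝔽 n c W) :=
  ⟨isOpen_germSet h, fun _ hy _ hz e => SpecPt.eq_of_eq (c := c) e hy.2 hz.2⟩

theorem IsSlice.image {c : C} {W : Set M} (h : IsSlice 𝔽 n c W) :
    (spectral 𝔽 n M C).proj '' (specSet 𝔽 n c W) = W := by
  ext x
  constructor
  · rintro ⟨y, hy, rfl⟩; exact hy.1
  · intro hx
    exact ⟨⟨x, locMk 𝔽 n C x c, mk_mem_grouplikes h.1 (h.3 x hx)⟩, ⟨hx, rfl⟩, rfl⟩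

theorem germ_eq_of_mem_specSet {c d : C} {W V : Set M} {y : spectral 𝔽 n M C} (hc : y ∈ specSet 𝔽 n c W)
    (hd : y ∈ specSet 𝔽 n d V) : c - d ∈ Nx 𝔽 n C ((spectral 𝔽 n M C).proj y) :=
  locMk_eq_iff.1 (hc.2.symm.trans hd.2)

/-- The element `f ∘ π|_{c_W}`, for `f` with compact support in `W`. -/
def IsSlice.gen {c : C} {W : Set M} (h : IsSlice 𝔽 n c W) (f : Cc 𝔽 n M) (hf : tsupport (f : M → 𝔽) ⊆ W) :
    (spectral 𝔽 n M C).cc 𝔽 := h.isElementary.mk f (hf.trans h.image.symm.subset)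

theorem IsSlice.comul_gen {c : C} {W : Set M} (h : IsSlice 𝔽 n c W) {f η : Cc 𝔽 n M} (hf : tsupport (f : M → 𝔽) ⊆ W)
    (hη : tsupport (η : M → 𝔽) ⊆ W) (e : η * f = f) :
    NUCoalgebra.comul (R := Cc 𝔽 n M) (h.gen f hf) = h.gen f hf ⊗ₜ[Plus (Cc 𝔽 n M)] h.gen η hη :=
  ManifoldSheaf.comul_mk h.isElementary _ _ e

theorem IsSlice.counit_gen {c : C} {W : Set M} (h : IsSlice 𝔽 n c W) {f : Cc 𝔽 n M} (hf : tsupport (f : M → 𝔽) ⊆ W) :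
    NUCoalgebra.counit (R := Cc 𝔽 n M) (h.gen f hf) = f :=
  ManifoldSheaf.counit_mk h.isElementary _

theorem spectral_induction (T : AddSubgroup ((spectral 𝔽 n M C).cc 𝔽))
    (hT : ∀ (c : C) (W : Set M) (h : IsSlice 𝔽 n c W) (f : Cc 𝔽 n M) (hf : tsupport (f : M → 𝔽) ⊆ W), h.gen f hf ∈ T)
    (u : (spectral 𝔽 n M C).cc 𝔽) : u ∈ T := by
  refine ManifoldSheaf.cc_eq_top {V | ∃ (c : C) (W : Set M), IsSlice 𝔽 n c W ∧ V = specSet 𝔽 n c W} ?_ ?_ T ?_ u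
  · rintro _ ⟨c, W, h, rfl⟩
    exact h.isElementary
  · intro y
    obtain ⟨c, W, h, hy⟩ := exists_slice' y
    exact ⟨_, ⟨c, W, h, rfl⟩, hy⟩
  · rintro _ ⟨c, W, h, rfl⟩ f hf
    exact hT c W h f (hf.trans h.image.subset)

theorem IsSlice.mul_counit {c : C} {W : Set M} (h : IsSlice 𝔽 n c W) {f : Cc 𝔽 n M}
    (hf : tsupport (f : M → 𝔽) ⊆ W) : f * NUCoalgebra.counit (R := Cc 𝔽 n M) c = f := by
  rw [mul_comm]
  exact ManifoldSheaf.mul_eq_self fun x hx => Cc.germ_eq_one.1 (h.normalized x (hf hx))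

end
end SheafCoalg

namespace SheafCoalg
noncomputable section

section Hom
variable {R : Type*} [NonUnitalCommRing R] {C : Type*} [AddCommGroup C] [Module (Plus R) C] [NUCoalgebra R C]
  {D : Type*} [AddCommGroup D] [Module (Plus R) D] [NUCoalgebra R D]

/-- `α` is a homomorphism of coalgebras over `R`. -/
structure IsCoalgHom (α : C →ₗ[Plus R] D) : Prop where
  map_comul : ∀ c, TensorProduct.map α α (NUCoalgebra.comul (R := R) c) = NUCoalgebra.comul (R := R) (α c)
  map_counit : ∀ c, NUCoalgebra.counit (R := R) (α c) = NUCoalgebra.counit (R := R) c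

variable (R C D) in
/-- The coalgebras `C` and `D` over `R` are isomorphic. -/
def CoalgIsomorphic : Prop := ∃ α : C ≃ₗ[Plus R] D, IsCoalgHom α.toLinearMap
end Hom

variable {𝔽 : Type} [RCLike 𝔽] {n : ℕ} {M : Type u} [TopologicalSpace M] [ChartedSpace (EuclideanSpace ℝ (Fin n)) M]

/-- The sheaves `E` and `F` on `M` are isomorphic: there is a diffeomorphism over `M`. -/
def ManifoldSheaf.Isomorphic (E : ManifoldSheaf.{u, w} n M) (F : ManifoldSheaf.{u, w₂} n M) : Prop :=
  ∃ Φ : Diffeomorph (𝓡 n) (𝓡 n) E F ∞, ∀ y : E, F.proj (Φ y) = E.proj y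

variable [T2Space M] [IsManifold (𝓡 n) ∞ M]
  {C : Type v} [AddCommGroup C] [Module (Plus (Cc 𝔽 n M)) C] [NUCoalgebra (Cc 𝔽 n M) C]

variable (𝔽 n M C) in
/-- The graph of `Ψ_C`: the submodule spanned by the pairs `(f ∘ π|_{c_W}, f c)`. -/
def psiGraph : Submodule (Plus (Cc 𝔽 n M)) ((spectral 𝔽 n M C).cc 𝔽 × C) :=
  Submodule.span _ {p | ∃ (c : C) (W : Set M) (h : IsSlice 𝔽 n c W) (f : Cc 𝔽 n M)
    (hf : tsupport (f : M → 𝔽) ⊆ W), p = (h.gen f hf, f ⋆ c)}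

theorem psi_aux {z : C} (hz : (0, z) ∈ psiGraph 𝔽 n M C) : z = 0 := by
  refine eq_zero_of_forall_mem_Nx (NUCoalgebra.locallyUnitary (R := Cc 𝔽 n M)) fun x => ?_
  choose c W h hy using fun y : (spectral 𝔽 n M C).proj ⁻¹' {x} => exists_slice' (y : spectral 𝔽 n M C)
  choose s hs using fun y => ManifoldSheaf.exists_localUnit (𝔽 := 𝔽) (h y).isElementary (hy y)
  let ev : ((spectral 𝔽 n M C).cc 𝔽 × C) →ₗ[Plus (Cc 𝔽 n M)] Sec 𝔽 (spectral 𝔽 n M C).proj :=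
    ((spectral 𝔽 n M C).cc 𝔽).subtype ∘ₗ LinearMap.fst _ _ _
  have key : (0, z) ∈ Nx 𝔽 n ((spectral 𝔽 n M C).cc 𝔽 × C) x := by
    refine mem_Nx_of_dual (spectral 𝔽 n M C).continuous_proj (fun y => (spectral 𝔽 n M C).isOpenMap_proj.nhds_le y) ev
      (ι := (spectral 𝔽 n M C).proj ⁻¹' {x}) (fun y => ((s y).sec, (s y).h ⋆ c y)) (fun y => y) (fun y => y.2)
      (fun y => (s y).sec_self) (fun y y' hne => (s y).sec_ne (y'.2.trans y.2.symm) fun e => hne (Subtype.ext e.symm))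
      ?_ (fun y => rfl)
    refine (?_ : psiGraph 𝔽 n M C ≤ _) hz
    refine Submodule.span_le.2 ?_
    rintro _ ⟨d, V, hV, f, hf, rfl⟩
    have hf' := hf.trans hV.image.symm.subset
    by_cases hx : x ∈ (spectral 𝔽 n M C).proj '' specSet 𝔽 n d V
    · obtain ⟨y, hyV, rfl⟩ := hx
      let y' : (spectral 𝔽 n M C).proj ⁻¹' {(spectral 𝔽 n M C).proj y} := ⟨y, rfl⟩
      obtain ⟨k, hk, e⟩ := ManifoldSheaf.exists_star_mk_eq hV.isElementary f hf' hyV (s y')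
      obtain ⟨k₂, hk₂, e₂⟩ := germ_eq_of_mem_specSet hyV (hy y')
      rw [smul_sub, sub_eq_zero] at e₂
      obtain ⟨k₃, hk₃, e₃⟩ := exists_mul_eq (s y').germ_eq
      have hmem : ((hV.gen f hf, f ⋆ d) - f ⋆ ((s y').sec, (s y').h ⋆ c y') : (spectral 𝔽 n M C).cc 𝔽 × C) ∈
          Nx 𝔽 n ((spectral 𝔽 n M C).cc 𝔽 × C) ((spectral 𝔽 n M C).proj y) := by
        refine ⟨k₂ * k₃ * k, by rw [map_mul, map_mul, hk, hk₂, hk₃, mul_one, mul_one], ?_⟩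
        rw [smul_sub, sub_eq_zero]
        refine Prod.ext ?_ ?_
        · change (k₂ * k₃ * k) ⋆ hV.isElementary.mk f hf' = (k₂ * k₃ * k) ⋆ f ⋆ (s y').sec
          exact (star_star (C := (spectral 𝔽 n M C).cc 𝔽) (k₂ * k₃) k _).symm.trans
            ((congrArg (Plus.of (k₂ * k₃) • ·) e).trans (star_star (C := (spectral 𝔽 n M C).cc 𝔽) (k₂ * k₃) k _))
        · change (k₂ * k₃ * k) ⋆ f ⋆ d = (k₂ * k₃ * k) ⋆ f ⋆ (s y').h ⋆ c y'
          have e4 : k₂ * k₃ * k * f = k₃ * k * f * k₂ := by ac_rfl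
          have e5 : k₂ * k₃ * k * (f * (s y').h) = k₂ * (k₃ * (s y').h) * k * f := by ac_rfl
          rw [star_star, star_star f, star_star, e5, e₃, e4, ← star_star _ k₂, e₂, star_star]
      rw [SetLike.mem_coe, ← sub_add_cancel ((hV.gen f hf, f ⋆ d) : (spectral 𝔽 n M C).cc 𝔽 × C) (f ⋆ ((s y').sec, (s y').h ⋆ c y'))]
      exact add_mem (Submodule.mem_sup_right hmem)
        (Submodule.mem_sup_left (Submodule.smul_mem _ _ (Submodule.subset_span ⟨y', rfl⟩)))
    · refine Submodule.mem_sup_right ?_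
      obtain ⟨-, k, hk, e⟩ := ManifoldSheaf.mk_mem_Nx hV.isElementary f hf' hx
      refine ⟨k, hk, Prod.ext (Subtype.ext ?_) ?_⟩
      · refine (ManifoldSheaf.star_elem _ k f).trans ?_
        rw [e]; exact ManifoldSheaf.elem_zero _
      · change k ⋆ f ⋆ d = 0
        rw [star_star, e, Plus.of_zero, zero_smul]
  exact Nx_map (LinearMap.snd _ _ _) key

variable (𝔽 n M C) in
/-- The projection of the graph to its first factor. -/
def psiGraphFst : psiGraph 𝔽 n M C →ₗ[Plus (Cc 𝔽 n M)] (spectral 𝔽 n M C).cc 𝔽 :=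
  LinearMap.fst (Plus (Cc 𝔽 n M)) ((spectral 𝔽 n M C).cc 𝔽) C ∘ₗ (psiGraph 𝔽 n M C).subtype

theorem psiGraph_bijective : Function.Bijective (psiGraphFst 𝔽 n M C) := by
  constructor
  · rw [injective_iff_map_eq_zero]
    rintro ⟨⟨a, b⟩, h⟩ hab
    obtain rfl : a = 0 := hab
    obtain rfl := psi_aux h
    rfl
  · intro u
    refine spectral_induction (LinearMap.range (psiGraphFst 𝔽 n M C)).toAddSubgroup (fun c W h f hf => ?_) u
    exact ⟨⟨(h.gen f hf, f ⋆ c), Submodule.subset_span ⟨c, W, h, f, hf, rfl⟩⟩, rfl⟩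

variable (𝔽 n M C) in
/-- The homomorphism `Ψ_C`, determined by `f ∘ π|_{c_W} ↦ f c` (see `Psi_gen` and `spectral_induction`);
it is a homomorphism of coalgebras (see `Psi_isCoalgHom`). -/
def Psi : (spectral 𝔽 n M C).cc 𝔽 →ₗ[Plus (Cc 𝔽 n M)] C :=
  LinearMap.snd _ _ _ ∘ₗ (psiGraph 𝔽 n M C).subtype ∘ₗ
    (LinearEquiv.ofBijective (psiGraphFst 𝔽 n M C) psiGraph_bijective).symm.toLinearMap

theorem Psi_gen {c : C} {W : Set M} (h : IsSlice 𝔽 n c W) (f : Cc 𝔽 n M) (hf : tsupport (f : M → 𝔽) ⊆ W) :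
    Psi 𝔽 n M C (h.gen f hf) = f ⋆ c := by
  have : (LinearEquiv.ofBijective (psiGraphFst 𝔽 n M C) psiGraph_bijective).symm (h.gen f hf) =
      ⟨(h.gen f hf, f ⋆ c), Submodule.subset_span ⟨c, W, h, f, hf, rfl⟩⟩ := by
    rw [LinearEquiv.symm_apply_eq]; rfl
  exact congrArg (fun p : psiGraph 𝔽 n M C => p.1.2) this

theorem Psi_isCoalgHom : IsCoalgHom (Psi 𝔽 n M C) where
  map_comul u := spectral_induction (LinearMap.eqLocus
      (TensorProduct.map (Psi 𝔽 n M C) (Psi 𝔽 n M C) ∘ₗ NUCoalgebra.comul (R := Cc 𝔽 n M))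
      (NUCoalgebra.comul (R := Cc 𝔽 n M) ∘ₗ Psi 𝔽 n M C)).toAddSubgroup (fun c W h f hf => by
    obtain ⟨η, hη, e⟩ := h.isElementary.exists_mul_eq_self (hf.trans h.image.symm.subset)
    rw [h.image] at hη
    change TensorProduct.map _ _ (NUCoalgebra.comul (R := Cc 𝔽 n M) (h.gen f hf)) =
      NUCoalgebra.comul (R := Cc 𝔽 n M) (Psi 𝔽 n M C (h.gen f hf))
    obtain ⟨c', hc'⟩ := h.weaklyGrouplike
    have e2 : f ⋆ c' = f ⋆ c := by
      conv_rhs => rw [← weaklyGrouplike_counit hc', star_star, h.mul_counit hf]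
    rw [h.comul_gen hf hη e, TensorProduct.map_tmul, Psi_gen, Psi_gen, map_smul, hc',
      ← TensorProduct.tmul_smul, e2, ← TensorProduct.smul_tmul, ← TensorProduct.smul_tmul, star_star, e]) u
  map_counit u := spectral_induction (LinearMap.eqLocus
      (NUCoalgebra.counit (R := Cc 𝔽 n M) ∘ₗ Psi 𝔽 n M C)
      (NUCoalgebra.counit (R := Cc 𝔽 n M))).toAddSubgroup (fun c W h f hf => by
    change NUCoalgebra.counit (R := Cc 𝔽 n M) (Psi 𝔽 n M C (h.gen f hf)) =
      NUCoalgebra.counit (R := Cc 𝔽 n M) (h.gen f hf)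
    rw [Psi_gen, h.counit_gen, map_smul, star_self, h.mul_counit hf]) u

variable (𝔽 n M) in
/-- The subset `Λ` of `C` normally generates `C`. -/
def NormallyGenerates (Λ : Set C) : Prop :=
  ∀ c : C, ∃ (k : ℕ) (f : Fin k → Cc 𝔽 n M) (d : Fin k → C),
    (∀ i, d i ∈ Λ ∧ ∀ x ∈ tsupport (f i : M → 𝔽), Normalized 𝔽 n (d i) x) ∧ c = ∑ i, f i ⋆ d i

variable (𝔽 n M) in
/-- The subset `Λ` of `C` is normally linearly independent (at every point of `M`). -/
def NormallyLinearIndependent (Λ : Set C) : Prop :=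
  ∀ (x : M) (k : ℕ) (c : Fin k → C), (∀ i, c i ∈ Λ ∧ Normalized 𝔽 n (c i) x) →
    ∀ f : Fin k → Cc 𝔽 n M, ∑ i, f i ⋆ c i = 0 →
      (∀ i, Cc.germ x (f i) = 0) ∨
        ∃ i j, i ≠ j ∧ ∃ g : Cc 𝔽 n M, Cc.germ x g = 1 ∧ g ⋆ c i = g ⋆ c j

variable (𝔽 n C) in
/-- The module `C_x` is freely generated by its grouplike elements over the ring of germs at `x`. -/
def FreelyGenerated (x : M) : Prop :=
  LinearIndependent (germRing 𝔽 n x) (fun ζ : grouplikes 𝔽 n C x => (ζ : Loc 𝔽 n C x)) ∧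
    Submodule.span (germRing 𝔽 n x) (grouplikes 𝔽 n C x) = ⊤

end
end SheafCoalg

open SheafCoalg

/-! Everything is decided in the stalks `C_x`, which are modules over rings of germs with an
identity. The link with `C` itself is `mem_grouplikes_iff`: the grouplike elements of `C_x` are
exactly the classes of the weakly grouplike elements of `C` normalized at `x`. In this dictionary
normal linear independence becomes linear independence of `G(C_x)` at every `x`, since a relation in
`C_x` lifts to a relation in `C` after multiplication by a function with germ one at `x`
(`normallyLinearIndependent_iff`). Normal generation becomes the statement that `G(C_x)` spans
`C_x`; passing back from the stalks to `C` works because membership in a submodule of a locally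
unitary module can be tested near each point (`mem_of_forall_exists_star_mem`). Thus (iii) and (iv)
are the same condition, `normal_iff_freelyGenerated`.

For a sheaf `E`, the stalk of its coalgebra at `x` is free on the fibre of `E` over `x`: a basis is
given by sections with germ one at one point of the fibre and zero at the others (`span_point`,
`linearIndependent_point`). These classes are grouplike, and there are no other grouplike elements:
in coordinates, the grouplike equation says that the coordinates are orthogonal idempotents, and a
ring of germs has only the idempotents 0 and 1 (`grouplike_mem_range_basis`, `germRing_idempotent`).
So (iv) holds for sheaf coalgebras, and its equivalent (iii) is transported along isomorphisms.

Given (iii), the range of `Psi` contains every product `f ⋆ d` used for normal generation, so `Psi`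
is onto. In the stalk at `x` it carries the basis of local units, indexed by the fibre of the
spectral sheaf, to distinct grouplike elements, so independence makes it injective. If `Psi` is
bijective, the spectral sheaf is a witness for (i).

The same description of the stalks recovers `E`: the points of `E` over `x` correspond to the
grouplike elements at `x`, and this bijection over `M` is continuous. A continuous map over `M`
between sheaves is automatically a local diffeomorphism (`isLocalDiffeomorph_of_proj_comp`), hence
the bijection is a diffeomorphism. -/

namespace SheafCoalg
noncomputable section

/-! ### Idempotents and grouplike elements of free modules -/

/-- Over a ring without nontrivial idempotents, the grouplike elements for the comultiplication determined
by `b i ↦ b i ⊗ b i` on a basis `b` are the elements of the basis. -/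
theorem grouplike_mem_range_basis {A N ι : Type*} [CommRing A] [Nontrivial A]
    (hA : ∀ a : A, a * a = a → a = 0 ∨ a = 1) [AddCommGroup N] [Module A N] (b : Module.Basis ι A N)
    (Δ : N →ₗ[A] N ⊗[A] N) (hΔ : ∀ i, Δ (b i) = b i ⊗ₜ b i) (ε : N →ₗ[A] A)
    {ζ : N} (h1 : Δ ζ = ζ ⊗ₜ ζ) (h2 : ε ζ = 1) : ζ ∈ Set.range b := by
  classical
  -- In the basis `b i ⊗ b j` the comultiplication is diagonal. Both sides are linear in `η`, so
  -- basis vectors suffice.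
  have e1 : ∀ (η : N) (i j : ι), (b.tensorProduct b).repr (Δ η) (i, j) = if i = j then b.repr η i else 0 := by
    intro η i j
    have : (Finsupp.lapply (i, j) ∘ₗ (b.tensorProduct b).repr.toLinearMap) ∘ₗ Δ =
        if i = j then Finsupp.lapply i ∘ₗ b.repr.toLinearMap else 0 := by
      refine b.ext fun k => ?_
      by_cases hij : i = j <;>
      by_cases hk : k = i <;>
      by_cases hkj : k = j <;>
      simp_all
    have := congrArg (fun l => l η) this
    split_ifs at this ⊢ <;> simpa using this
  -- Comparing with the coordinates of `ζ ⊗ ζ` shows that the coordinates of `ζ` are pairwise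
  -- orthogonal idempotents.
  have e2 : ∀ i j, b.repr ζ j * b.repr ζ i = if i = j then b.repr ζ i else 0 := fun i j => by
    rw [← e1, h1, Module.Basis.tensorProduct_repr_tmul_apply, smul_eq_mul]
  -- If one coordinate is 1, orthogonality annihilates the others and `ζ` is that basis vector.
  -- Otherwise all coordinates are 0, so `ζ = 0`, which the counit condition excludes.
  by_cases h : ∃ i, b.repr ζ i = 1
  · obtain ⟨i, hi⟩ := h
    refine ⟨i, b.repr.injective (Finsupp.ext fun j => ?_)⟩
    by_cases hij : i = j
    · subst hij; simp [hi]
    · have := e2 i j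
      rw [hi, mul_one, if_neg hij] at this
      simp [this, hij]
  · have h0 : b.repr ζ = 0 := Finsupp.ext fun i =>
      (hA _ ((e2 i i).trans (if_pos rfl))).resolve_right fun hi => h ⟨i, hi⟩
    rw [LinearEquiv.map_eq_zero_iff] at h0
    rw [h0, map_zero] at h2
    exact absurd h2 zero_ne_one

variable {𝔽 : Type} [RCLike 𝔽] {n : ℕ} {M : Type u} [TopologicalSpace M] [ChartedSpace (EuclideanSpace ℝ (Fin n)) M]

/-- An idempotent function takes only the values 0 and 1 near `x`, because `𝔽` is a field. By
continuity at `x` it stays away from the value that it does not take at `x`, so its germ is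
constant. -/
theorem germRing_idempotent {x : M} (γ : germRing 𝔽 n x) (h : γ * γ = γ) : γ = 0 ∨ γ = 1 := by
  obtain ⟨_, f, hf, rfl⟩ := γ
  have h1 : ∀ᶠ y in 𝓝 x, f y * f y = f y := Germ.coe_eq.1 (congrArg Subtype.val h)
  have hc : ContinuousAt f x := hf.self_of_nhds.continuousAt
  have h2 : ∀ᶠ y in 𝓝 x, f y = 0 ∨ f y = 1 := by
    filter_upwards [h1] with y hy
    rcases eq_or_ne (f y) 0 with h0 | h0
    · exact Or.inl h0
    · exact Or.inr (mul_right_cancel₀ h0 (hy.trans (one_mul _).symm))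
  rcases h2.self_of_nhds with hx | hx
  · refine Or.inl (Subtype.ext (Germ.coe_eq.2 ?_))
    filter_upwards [h2, hc.eventually_ne (hx.trans_ne zero_ne_one)] with y hy hy' using hy.resolve_right hy'
  · refine Or.inr (Subtype.ext (Germ.coe_eq.2 ?_))
    filter_upwards [h2, hc.eventually_ne (hx.trans_ne one_ne_zero)] with y hy hy' using hy.resolve_left hy'

/-! ### Normalization, normal generation and local-to-global arguments -/

theorem tsupport_smul_subset (a : Plus (Cc 𝔽 n M)) (f : Cc 𝔽 n M) :
    tsupport ((a • f : Cc 𝔽 n M) : M → 𝔽) ⊆ tsupport (f : M → 𝔽) :=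
  closure_mono fun x hx hx0 => hx (by
    change a.int • (f : M → 𝔽) x + (a.part : M → 𝔽) x * (f : M → 𝔽) x = 0
    rw [hx0, mul_zero, smul_zero, add_zero])

theorem smul_star {C : Type v} [AddCommGroup C] [Module (Plus (Cc 𝔽 n M)) C] (a : Plus (Cc 𝔽 n M))
    (f : Cc 𝔽 n M) (c : C) : a • f ⋆ c = (a • f) ⋆ c := by
  rw [← mul_smul, Plus.mul_of]; rfl

section Normal
variable {C : Type v} [AddCommGroup C] [Module (Plus (Cc 𝔽 n M)) C] [NUCoalgebra (Cc 𝔽 n M) C]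

theorem Normalized.eventually {c : C} {x : M} (h : Normalized 𝔽 n c x) : ∀ᶠ y in 𝓝 x, Normalized 𝔽 n c y :=
  (Cc.germ_eq_one.1 h).eventuallyEq_nhds.mono fun _ hy => Cc.germ_eq_one.2 hy

/-- Multiplying a coefficient `f` by a scalar does not enlarge its support, so it keeps the
normalization condition. The finite sums of admissible products therefore form a submodule, and
normal generation becomes a question about a span, which can be examined locally. -/
theorem normallyGenerates_iff {Λ : Set C} : NormallyGenerates 𝔽 n M Λ ↔
    Submodule.span (Plus (Cc 𝔽 n M)) {c | ∃ (f : Cc 𝔽 n M) (d : C),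
      d ∈ Λ ∧ (∀ x ∈ tsupport (f : M → 𝔽), Normalized 𝔽 n d x) ∧ f ⋆ d = c} = ⊤ := by
  rw [Submodule.eq_top_iff']
  refine forall_congr' fun c => ⟨?_, fun h => ?_⟩
  · rintro ⟨k, f, d, h, rfl⟩
    exact sum_mem fun i _ => Submodule.subset_span ⟨f i, d i, (h i).1, (h i).2, rfl⟩
  · obtain ⟨k, a, g, rfl⟩ := Submodule.mem_span_set'.1 h
    choose f d hd hf e using fun i => (g i).2
    exact ⟨k, fun i => a i • f i, d, fun i => ⟨hd i, fun x hx => hf i x (tsupport_smul_subset _ _ hx)⟩,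
      Finset.sum_congr rfl fun i _ => by rw [← e, smul_star]⟩

end Normal

variable [T2Space M] [IsManifold (𝓡 n) ∞ M]

section Module
variable {C : Type v} [AddCommGroup C] [Module (Plus (Cc 𝔽 n M)) C]

/-- The quotient `C ⧸ T` inherits local units from `C`, and the hypothesis says that the class of
`c` vanishes in each of its stalks. An element of a locally unitary module with this property is
zero. -/
theorem mem_of_forall_exists_star_mem (hC : LocallyUnitary (Cc 𝔽 n M) C) (T : Submodule (Plus (Cc 𝔽 n M)) C)
    {c : C} (h : ∀ x : M, ∃ k : Cc 𝔽 n M, Cc.germ x k = 1 ∧ k ⋆ c ∈ T) : c ∈ T := by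
  have hCT : LocallyUnitary (Cc 𝔽 n M) (C ⧸ T) := locallyUnitary_of_forall fun q => by
    obtain ⟨d, rfl⟩ := T.mkQ_surjective q
    obtain ⟨r, hr⟩ := hC {d}
    exact ⟨r, by rw [← map_smul, hr d (Finset.mem_singleton_self d)]⟩
  refine (Submodule.Quotient.mk_eq_zero T).1 (eq_zero_of_forall_mem_Nx hCT fun x => ?_)
  obtain ⟨k, hk, hkc⟩ := h x
  exact ⟨k, hk, (Submodule.Quotient.mk_eq_zero T).2 hkc⟩

theorem locMk_star_of_germ_eq_zero {x : M} {f : Cc 𝔽 n M} (hf : Cc.germ x f = 0) (c : C) :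
    locMk 𝔽 n C x (f ⋆ c) = 0 := by
  rw [← germ_smul, hf, zero_smul]

/-- A function that has germ one at `x` has germ one at all nearby points, so the function
witnessing the equality at `x` witnesses it there too. -/
theorem eventually_locMk_eq {x : M} {c d : C} (h : locMk 𝔽 n C x c = locMk 𝔽 n C x d) :
    ∀ᶠ y in 𝓝 x, locMk 𝔽 n C y c = locMk 𝔽 n C y d := by
  obtain ⟨k, hk, h⟩ := locMk_eq_iff.1 h
  filter_upwards [(Cc.germ_eq_one.1 hk).eventuallyEq_nhds] with y hy
  exact locMk_eq_iff.2 ⟨k, Cc.germ_eq_one.2 hy, h⟩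

end Module

variable {C : Type v} [AddCommGroup C] [Module (Plus (Cc 𝔽 n M)) C] [NUCoalgebra (Cc 𝔽 n M) C]

/-! ### Conditions (iii) and (iv) compared in the stalks -/

theorem mem_grouplikes_iff {x : M} {ζ : Loc 𝔽 n C x} :
    ζ ∈ grouplikes 𝔽 n C x ↔ ∃ c ∈ weaklyGrouplike 𝔽 n M C, Normalized 𝔽 n c x ∧ locMk 𝔽 n C x c = ζ := by
  constructor
  · intro h
    obtain ⟨c, W, hc, hx, e⟩ := exists_weaklyGrouplike h
    exact ⟨c, hc.weaklyGrouplike, hc.normalized x hx, e⟩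
  · rintro ⟨c, hc, hx, rfl⟩
    exact mk_mem_grouplikes hc hx

/-- In a normal decomposition a summand contributes to the stalk at `x` only if `x` lies in the
support of its coefficient, and then its weakly grouplike factor is normalized at `x`, so it has a
grouplike class. -/
theorem NormallyGenerates.span_grouplikes (h : NormallyGenerates 𝔽 n M (weaklyGrouplike 𝔽 n M C)) (x : M) :
    Submodule.span (germRing 𝔽 n x) (grouplikes 𝔽 n C x) = ⊤ := by
  refine Submodule.eq_top_iff'.2 fun ζ => ?_
  obtain ⟨c, rfl⟩ := locMk_surjective x ζ
  obtain ⟨k, f, d, hd, rfl⟩ := h c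
  rw [map_sum]
  refine sum_mem fun i _ => ?_
  by_cases hx : x ∈ tsupport (f i : M → 𝔽)
  · rw [← germ_smul]
    exact Submodule.smul_mem _ _ (Submodule.subset_span (mk_mem_grouplikes (hd i).1 ((hd i).2 x hx)))
  · rw [locMk_star_of_germ_eq_zero (Cc.germ_eq_zero.2 (ManifoldSheaf.eventually_zero hx))]
    exact zero_mem _

/-- Near each point, `c` agrees with an element `t` of the span of admissible products: a
combination of grouplike elements of the stalk is lifted term by term, with bump functions cutting
the lifts down to where they are normalized. -/
theorem normallyGenerates_of_span_grouplikes
    (h : ∀ x : M, Submodule.span (germRing 𝔽 n x) (grouplikes 𝔽 n C x) = ⊤) :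
    NormallyGenerates 𝔽 n M (weaklyGrouplike 𝔽 n M C) := by
  refine normallyGenerates_iff.2 (Submodule.eq_top_iff'.2 fun c =>
    mem_of_forall_exists_star_mem (NUCoalgebra.locallyUnitary (R := Cc 𝔽 n M)) _ fun x => ?_)
  set T := Submodule.span (Plus (Cc 𝔽 n M)) {c : C | ∃ (f : Cc 𝔽 n M) (d : C),
    d ∈ weaklyGrouplike 𝔽 n M C ∧ (∀ x ∈ tsupport (f : M → 𝔽), Normalized 𝔽 n d x) ∧ f ⋆ d = c}
  -- Equality of classes at `x` means equality after multiplication by some `k` with germ one at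
  -- `x`, so `k ⋆ c = k ⋆ t` lies in `T`.
  suffices hT : ∃ t ∈ T, locMk 𝔽 n C x t = locMk 𝔽 n C x c by
    obtain ⟨t, ht, e⟩ := hT
    obtain ⟨k, hk, hkc⟩ := locMk_eq_iff.1 e
    rw [smul_sub, sub_eq_zero] at hkc
    exact ⟨k, hk, hkc ▸ T.smul_mem _ ht⟩
  have hc : locMk 𝔽 n C x c ∈ Submodule.span (germRing 𝔽 n x) (grouplikes 𝔽 n C x) := h x ▸ Submodule.mem_top
  generalize locMk 𝔽 n C x c = ζ at hc
  induction hc using Submodule.span_induction with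
  | mem ζ hζ =>
    obtain ⟨d, hd, hx, rfl⟩ := mem_grouplikes_iff.1 hζ
    -- Being normalized is an open condition, so there is room for a bump function supported where
    -- `d` is normalized.
    obtain ⟨f, hf, hfs⟩ := Cc.exists_bump (𝔽 := 𝔽) (n := n) x hx.eventually
    refine ⟨f ⋆ d, Submodule.subset_span ⟨f, d, hd, hfs, rfl⟩, ?_⟩
    rw [← germ_smul, Cc.germ_eq_one.2 hf, one_smul]
  | zero => exact ⟨0, zero_mem _, map_zero _⟩
  | add ζ η _ _ h1 h2 =>
    obtain ⟨s, hs, rfl⟩ := h1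
    obtain ⟨t, ht, rfl⟩ := h2
    exact ⟨s + t, add_mem hs ht, map_add _ _ _⟩
  | smul γ ζ _ h1 =>
    obtain ⟨t, ht, rfl⟩ := h1
    obtain ⟨f, rfl⟩ := Cc.exists_germ_eq x γ
    exact ⟨f ⋆ t, T.smul_mem _ ht, (germ_smul f t).symm⟩

/-- The second alternative in normal linear independence says precisely that two of the given
elements have the same class at `x`. What remains is the independence of families of distinct
grouplike elements. -/
theorem normallyLinearIndependent_iff : NormallyLinearIndependent 𝔽 n M (weaklyGrouplike 𝔽 n M C) ↔
    ∀ x : M, LinearIndependent (germRing 𝔽 n x) (fun ζ : grouplikes 𝔽 n C x => (ζ : Loc 𝔽 n C x)) := by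
  refine forall_congr' fun x => ⟨fun h => ?_, fun h k c hc f hf => ?_⟩
  · rw [linearIndependent_iff']
    intro s g hg ζ hζ
    choose c hc hx e using fun ζ : grouplikes 𝔽 n C x => mem_grouplikes_iff.1 ζ.2
    choose f hf using fun ζ : grouplikes 𝔽 n C x => Cc.exists_germ_eq x (g ζ)
    have h0 : locMk 𝔽 n C x (∑ ζ ∈ s, f ζ ⋆ c ζ) = 0 := by
      rw [map_sum, ← hg]
      exact Finset.sum_congr rfl fun ζ _ => by rw [← germ_smul, hf, e]
    -- The lifted sum vanishes only modulo `N_x(C)`. Multiplication by `k` gives a true relation in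
    -- `C` and leaves the germs at `x` of the coefficients unchanged.
    obtain ⟨k, hk, hk0⟩ := locMk_eq_zero.1 h0
    rw [Finset.smul_sum, ← Finset.sum_coe_sort, ← s.equivFin.symm.sum_comp] at hk0
    rcases h s.card (fun i => c (s.equivFin.symm i)) (fun i => ⟨hc _, hx _⟩)
      (fun i => k * f (s.equivFin.symm i)) (by simpa only [star_star] using hk0) with h1 | ⟨i, j, hij, q, hq, e1⟩
    · have := h1 (s.equivFin ⟨ζ, hζ⟩)
      rwa [map_mul, hk, one_mul, Equiv.symm_apply_apply, hf] at this
    -- Coinciding classes are impossible for different indices: the lifts represent distinct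
    -- grouplike elements.
    · refine absurd ?_ hij
      refine s.equivFin.symm.injective (Subtype.ext (Subtype.ext ?_))
      rw [← e, ← e, locMk_eq_iff]
      exact ⟨q, hq, by rw [smul_sub, sub_eq_zero, e1]⟩
  -- With distinct classes the relation descends to a relation between different grouplike elements;
  -- with a repeated class the second alternative holds outright.
  · by_cases hinj : Function.Injective fun i => locMk 𝔽 n C x (c i)
    · refine Or.inl (Fintype.linearIndependent_iff.1 (h.comp
        (fun i => ⟨_, mk_mem_grouplikes (hc i).1 (hc i).2⟩) fun i j hij => hinj (congrArg Subtype.val hij)) _ ?_)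
      simp only [Function.comp_apply, germ_smul, ← map_sum]
      rw [hf, map_zero]
    · simp only [Function.Injective, not_forall] at hinj
      obtain ⟨i, j, e, hij⟩ := hinj
      obtain ⟨q, hq, e⟩ := locMk_eq_iff.1 e
      exact Or.inr ⟨i, j, hij, q, hq, by rwa [smul_sub, sub_eq_zero] at e⟩

theorem normal_iff_freelyGenerated : (NormallyGenerates 𝔽 n M (weaklyGrouplike 𝔽 n M C) ∧
      NormallyLinearIndependent 𝔽 n M (weaklyGrouplike 𝔽 n M C)) ↔ ∀ x : M, FreelyGenerated 𝔽 n C x := by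
  rw [normallyLinearIndependent_iff]
  exact ⟨fun h x => ⟨h.2 x, h.1.span_grouplikes x⟩,
    fun h => ⟨normallyGenerates_of_span_grouplikes fun x => (h x).2, fun x => (h x).1⟩⟩

/-! ### Bijectivity of `Psi` -/

theorem Psi_surjective (h : NormallyGenerates 𝔽 n M (weaklyGrouplike 𝔽 n M C)) :
    Function.Surjective (Psi 𝔽 n M C) := by
  refine LinearMap.range_eq_top.1 (top_unique ?_)
  rw [← normallyGenerates_iff.1 h, Submodule.span_le]
  rintro _ ⟨f, d, hd, hf, rfl⟩
  -- The largest open set on which `d` is normalized. It contains the support of `f`, since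
  -- normalization at a point persists nearby.
  have hs : IsSlice 𝔽 n d (interior {x | Normalized 𝔽 n d x}) :=
    ⟨hd, isOpen_interior, fun x hx => interior_subset (s := {x | Normalized 𝔽 n d x}) hx⟩
  exact ⟨hs.gen f fun x hx => mem_interior_iff_mem_nhds.2 (hf x hx).eventually, Psi_gen _ _ _⟩

/-- Modulo `N_x`, an element `z` of the kernel is a combination of local units at the points over
`x`. Applying `Psi` yields a relation between distinct grouplike elements of `C_x`, so all
coefficients have germ zero at `x` and `z` itself lies in `N_x`. This holds at every `x`, so `z =
0`. -/
theorem Psi_injective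
    (h : ∀ x : M, LinearIndependent (germRing 𝔽 n x) (fun ζ : grouplikes 𝔽 n C x => (ζ : Loc 𝔽 n C x))) :
    Function.Injective (Psi 𝔽 n M C) := by
  rw [injective_iff_map_eq_zero]
  intro z hz
  refine eq_zero_of_forall_mem_Nx ManifoldSheaf.cc_locallyUnitary fun x => ?_
  have hs : ∀ y : (spectral 𝔽 n M C).proj ⁻¹' {x}, ∃ (s : ManifoldSheaf.LocalUnit 𝔽 (y : spectral 𝔽 n M C))
      (c : C) (W : Set M), IsSlice 𝔽 n c W ∧ (y : spectral 𝔽 n M C) ∈ specSet 𝔽 n c W ∧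
        locMk 𝔽 n C x (Psi 𝔽 n M C s.sec) = locMk 𝔽 n C x c := by
    rintro ⟨y, hyx⟩
    obtain ⟨c, W, hc, hy⟩ := exists_slice' y
    obtain ⟨b, hb, hbs⟩ := Cc.exists_bump (𝔽 := 𝔽) (n := n) _ (hc.isOpen.mem_nhds hy.1)
    -- The local unit is chosen on the slice `c_W`, so that it is a generator and `Psi` sends it to
    -- `b ⋆ c`, whose class at `x` is that of `c`.
    refine ⟨⟨specSet 𝔽 n c W, hc.isElementary, hy, b, hbs.trans hc.image.symm.subset, Cc.germ_eq_one.2 hb⟩,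
      c, W, hc, hy, ?_⟩
    obtain rfl : (spectral 𝔽 n M C).proj y = x := hyx
    refine (congrArg (locMk 𝔽 n C _) (Psi_gen hc b hbs)).trans ((germ_smul b c).symm.trans ?_)
    have hb' : Cc.germ ((spectral 𝔽 n M C).proj y) b = 1 := Cc.germ_eq_one.2 hb
    rw [hb', one_smul]
  choose s c W hc hy hs using hs
  obtain ⟨t, ht, r, hr, rfl⟩ := Submodule.mem_sup.1 (ManifoldSheaf.span_localUnit_sup x s z)
  obtain ⟨a, rfl⟩ := Finsupp.mem_span_range_iff_exists_finsupp.1 ht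
  have hg : ∀ y, locMk 𝔽 n C x (Psi 𝔽 n M C (s y).sec) ∈ grouplikes 𝔽 n C x := fun y => by
    rw [hs y]
    exact mk_mem_grouplikes (hc y).weaklyGrouplike ((hc y).normalized x (y.2 ▸ (hy y).1))
  -- A point of the spectral sheaf is determined by its base point and its grouplike germ, and the
  -- image of its local unit has exactly this germ.
  have hinj : Function.Injective fun y => (⟨_, hg y⟩ : grouplikes 𝔽 n C x) := fun y y' e => by
    have e1 := (hs y).symm.trans ((congrArg Subtype.val e).trans (hs y'))
    -- The base point of `y'` equals `x` only propositionally, and the stalk is a type depending on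
    -- it. Quantifying over `x'` moves the equality to the stalk where `y'` lives.
    have e2 : ∀ x', x' = x → locMk 𝔽 n C x' (c y') = locMk 𝔽 n C x' (c y) := by
      rintro _ rfl
      exact e1.symm
    exact Subtype.ext (SpecPt.eq_of_eq (y.2.trans y'.2.symm) (hy y).2 ((hy y').2.trans (e2 _ y'.2)))
  have h1 : ∑ y ∈ a.support, toGerm x (a y) • locMk 𝔽 n C x (Psi 𝔽 n M C (s y).sec) = 0 := by
    have h2 := congrArg (locMk 𝔽 n C x) hz
    rw [map_add, map_add, locMk_eq_zero.2 (Nx_map _ hr), add_zero, map_zero, Finsupp.sum, map_sum, map_sum] at h2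
    refine Eq.trans (Finset.sum_congr rfl fun y _ => ?_) h2
    rw [toGerm_smul, map_smul, map_smul]
  have h3 := linearIndependent_iff'.1 ((h x).comp _ hinj) a.support (fun y => toGerm x (a y)) h1
  exact add_mem (sum_mem fun y hy => smul_mem_Nx (h3 y hy) _) hr

end
end SheafCoalg

namespace SheafCoalg
noncomputable section

/-! ### Transport along isomorphisms of coalgebras -/

section Transport
variable {R : Type*} [NonUnitalCommRing R] {C : Type*} [AddCommGroup C] [Module (Plus R) C] [NUCoalgebra R C]
  {D : Type*} [AddCommGroup D] [Module (Plus R) D] [NUCoalgebra R D]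

theorem IsCoalgHom.symm {α : C ≃ₗ[Plus R] D} (h : IsCoalgHom α.toLinearMap) : IsCoalgHom α.symm.toLinearMap where
  map_comul d := by
    obtain ⟨c, rfl⟩ := α.surjective d
    have h1 := h.map_comul c
    change _ = NUCoalgebra.comul (R := R) (α c) at h1
    rw [← h1, ← LinearMap.comp_apply, ← TensorProduct.map_comp]
    simp
  map_counit d := by
    obtain ⟨c, rfl⟩ := α.surjective d
    have h1 := h.map_counit c
    change NUCoalgebra.counit (R := R) (α c) = _ at h1
    rw [h1]
    simp

theorem CoalgIsomorphic.symm (h : CoalgIsomorphic R C D) : CoalgIsomorphic R D C := by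
  obtain ⟨α, hα⟩ := h
  exact ⟨α.symm, hα.symm⟩
end Transport

variable {𝔽 : Type} [RCLike 𝔽] {n : ℕ} {M : Type u} [TopologicalSpace M] [ChartedSpace (EuclideanSpace ℝ (Fin n)) M]

section Transport
variable {C : Type v} [AddCommGroup C] [Module (Plus (Cc 𝔽 n M)) C] [NUCoalgebra (Cc 𝔽 n M) C]
  {D : Type w} [AddCommGroup D] [Module (Plus (Cc 𝔽 n M)) D] [NUCoalgebra (Cc 𝔽 n M) D]

theorem IsCoalgHom.weaklyGrouplike {α : C →ₗ[Plus (Cc 𝔽 n M)] D} (h : IsCoalgHom α) {c : C}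
    (hc : c ∈ weaklyGrouplike 𝔽 n M C) : α c ∈ weaklyGrouplike 𝔽 n M D := by
  obtain ⟨c', hc'⟩ := hc
  exact ⟨α c', by rw [← h.map_comul, hc', TensorProduct.map_tmul]⟩

theorem IsCoalgHom.normalized {α : C →ₗ[Plus (Cc 𝔽 n M)] D} (h : IsCoalgHom α) {c : C} {x : M} :
    Normalized 𝔽 n (α c) x ↔ Normalized 𝔽 n c x := by
  rw [Normalized, Normalized, h.map_counit]

theorem NormallyGenerates.of_isomorphic (h : CoalgIsomorphic (Cc 𝔽 n M) C D)
    (hC : NormallyGenerates 𝔽 n M (weaklyGrouplike 𝔽 n M C)) :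
    NormallyGenerates 𝔽 n M (weaklyGrouplike 𝔽 n M D) := by
  obtain ⟨α, hα⟩ := h
  intro d
  obtain ⟨k, f, c, hc, e⟩ := hC (α.symm d)
  refine ⟨k, f, fun i => α (c i), fun i => ⟨hα.weaklyGrouplike (hc i).1, fun x hx =>
    hα.normalized.2 ((hc i).2 x hx)⟩, ?_⟩
  rw [← α.apply_symm_apply d, e, map_sum]
  simp only [map_smul]

/-- Relations are pushed forward from `C` to `D`, so independence passes backwards along the
isomorphism; injectivity pulls the second alternative back. -/
theorem NormallyLinearIndependent.of_isomorphic (h : CoalgIsomorphic (Cc 𝔽 n M) C D)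
    (hD : NormallyLinearIndependent 𝔽 n M (weaklyGrouplike 𝔽 n M D)) :
    NormallyLinearIndependent 𝔽 n M (weaklyGrouplike 𝔽 n M C) := by
  obtain ⟨α, hα⟩ := h
  intro x k c hc f hf
  refine (hD x k (fun i => α (c i)) (fun i => ⟨hα.weaklyGrouplike (hc i).1, hα.normalized.2 (hc i).2⟩) f ?_).imp
    id fun ⟨i, j, hij, g, hg, e⟩ => ⟨i, j, hij, g, hg, α.injective ?_⟩
  · simp only [← map_smul, ← map_sum]
    rw [hf, map_zero]
  · simpa only [← map_smul] using e
end Transport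

/-! ### Continuous maps between sheaves -/

/-- Near `y` the map `φ` is the projection of `E` followed by a local inverse of the projection of
`F`. Continuity of `φ` is what keeps its values in the sheet where this inverse is valid. -/
theorem isLocalDiffeomorph_of_proj_comp {E : ManifoldSheaf.{u, w} n M} {F : ManifoldSheaf.{u, w₂} n M} {φ : E → F}
    (hφ : Continuous φ) (hp : ∀ y, F.proj (φ y) = E.proj y) : IsLocalDiffeomorph (𝓡 n) (𝓡 n) ∞ φ := by
  intro y
  have hF := F.isLocalDiffeomorph (φ y)
  have hc : IsLocalDiffeomorphAt (𝓡 n) (𝓡 n) ∞ (hF.localInverse ∘ E.proj) y := by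
    have hG := hF.localInverse_isLocalDiffeomorphAt
    rw [hp y] at hG
    exact (E.isLocalDiffeomorph y).comp (𝓡 n) F hG
  have he : hF.localInverse ∘ E.proj =ᶠ[𝓝 y] φ := by
    filter_upwards [hφ.continuousAt.eventually hF.localInverse_eventuallyEq_left] with z hz
    rw [Function.comp_apply, ← hp z]
    exact hz
  -- The partial diffeomorphism represents the composite; restricted to an open `V` on which the
  -- composite equals `φ`, it represents `φ`.
  obtain ⟨V, hV, hVo, hyV⟩ := eventually_nhds_iff.1 he
  obtain ⟨Φ, hy, hΦ⟩ := hc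
  let Φ' : PartialDiffeomorph (𝓡 n) (𝓡 n) E F ∞ :=
    { __ := Φ.toOpenPartialHomeomorph.restrOpen V hVo
      contMDiffOn_toFun := Φ.contMDiffOn_toFun.mono Set.inter_subset_left
      contMDiffOn_invFun := Φ.contMDiffOn_invFun.mono Set.inter_subset_left }
  exact ⟨Φ', ⟨hy, hyV⟩, fun z hz => (hV z hz.2).symm.trans (hΦ hz.1)⟩

theorem isomorphic_of_bijective {E : ManifoldSheaf.{u, w} n M} {F : ManifoldSheaf.{u, w₂} n M} {φ : E → F}
    (hφ : Continuous φ) (hb : Function.Bijective φ) (hp : ∀ y, F.proj (φ y) = E.proj y) : E.Isomorphic F :=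
  ⟨(isLocalDiffeomorph_of_proj_comp hφ hp).diffeomorphOfBijective hb, hp⟩

variable [T2Space M] [IsManifold (𝓡 n) ∞ M]

/-! ### Stalks and grouplike elements of a sheaf coalgebra -/

namespace ManifoldSheaf
variable {E : ManifoldSheaf.{u, w} n M}

theorem IsElementary.mk_mem_weaklyGrouplike {V : Set E} (hV : E.IsElementary V) {h : Cc 𝔽 n M}
    (hh : tsupport (h : M → 𝔽) ⊆ E.proj '' V) : hV.mk h hh ∈ weaklyGrouplike 𝔽 n M (E.cc 𝔽) := by
  obtain ⟨η, hη, e⟩ := hV.exists_mul_eq_self hh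
  exact ⟨hV.mk η hη, comul_mk hV hh hη e⟩

theorem LocalUnit.normalized {y : E} (s : LocalUnit 𝔽 y) : Normalized 𝔽 n s.sec (E.proj y) :=
  (congrArg (Cc.germ (E.proj y)) (counit_mk s.elementary s.supp)).trans s.germ_eq

theorem LocalUnit.sec_mem_weaklyGrouplike {y : E} (s : LocalUnit 𝔽 y) : s.sec ∈ weaklyGrouplike 𝔽 n M (E.cc 𝔽) :=
  s.elementary.mk_mem_weaklyGrouplike s.supp

theorem LocalUnit.mem_grouplikes {y : E} (s : LocalUnit 𝔽 y) :
    locMk 𝔽 n (E.cc 𝔽) (E.proj y) s.sec ∈ grouplikes 𝔽 n (E.cc 𝔽) (E.proj y) :=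
  mk_mem_grouplikes s.sec_mem_weaklyGrouplike s.normalized

variable (𝔽) in
/-- A section whose germ is `1` at `y` and `0` at the other points of the fibre through `y`. -/
def point (y : E) : E.cc 𝔽 := (Classical.arbitrary (LocalUnit 𝔽 y)).sec

/-- Local units at the points over `x` generate all sections modulo `N_x`, and scalars act on the
stalk through their germs at `x`. -/
theorem span_point (x : M) : Submodule.span (germRing 𝔽 n x)
    (Set.range fun y : E.proj ⁻¹' {x} => locMk 𝔽 n (E.cc 𝔽) x (point 𝔽 (y : E))) = ⊤ := by
  refine Submodule.eq_top_iff'.2 fun ζ => ?_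
  obtain ⟨u, rfl⟩ := locMk_surjective x ζ
  obtain ⟨t, ht, r, hr, rfl⟩ := Submodule.mem_sup.1 (span_localUnit_sup x (fun y => Classical.arbitrary _) u)
  rw [map_add, locMk_eq_zero.2 hr, add_zero]
  induction ht using Submodule.span_induction with
  | mem t ht =>
    obtain ⟨y, rfl⟩ := ht
    exact Submodule.subset_span ⟨y, rfl⟩
  | zero => rw [map_zero]; exact zero_mem _
  | add a b _ _ ha hb => rw [map_add]; exact add_mem ha hb
  | smul a t _ ht => rw [map_smul, ← toGerm_smul]; exact Submodule.smul_mem _ _ ht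

/-- Taking the germ at a point `y` of the fibre isolates one coefficient: sections in `N_x` have
germ zero at `y`, and so have the local units of the other points of the fibre. What is left is the
coefficient pulled back along the projection, an open map, so the coefficient has germ zero at `x`.
-/
theorem linearIndependent_point (x : M) : LinearIndependent (germRing 𝔽 n x)
    (fun y : E.proj ⁻¹' {x} => locMk 𝔽 n (E.cc 𝔽) x (point 𝔽 (y : E))) := by
  rw [linearIndependent_iff']
  intro S g hg y hy
  choose a ha using fun y => toGerm_surjective (𝔽 := 𝔽) (n := n) x (g y)
  have h1 : ∑ y ∈ S, a y • point 𝔽 (y : E) ∈ Nx 𝔽 n (E.cc 𝔽) x := by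
    rw [← locMk_eq_zero, map_sum, ← hg]
    exact Finset.sum_congr rfl fun y _ => by rw [map_smul, ← ha, toGerm_smul]
  obtain ⟨y, rfl⟩ := y
  have h2 := Sec.eq_zero_of_mem_Nx E.continuous_proj (Nx_map (E.cc 𝔽).subtype h1)
  rw [map_sum] at h2
  have h3 := (Finset.sum_apply (M := fun z : E => (𝓝 z).Germ 𝔽) y S _).symm.trans h2
  rw [Finset.sum_eq_single ⟨y, rfl⟩] at h3
  · rw [← ha]
    exact Sec.toGerm_eq_zero (E.isOpenMap_proj.nhds_le y) (LocalUnit.sec_self _) h3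
  · intro z _ hz
    rw [map_smul, Sec.smul_apply]
    refine (congrArg _ (LocalUnit.sec_ne _ z.2.symm fun e => hz (Subtype.ext e.symm))).trans (mul_zero _)
  · intro hc; exact absurd hy hc

/-- The classes of the local units form a basis of grouplike elements, and by
`grouplike_mem_range_basis` such a basis exhausts the grouplike elements. -/
theorem mem_grouplikes_iff_exists_point {x : M} {ζ : Loc 𝔽 n (E.cc 𝔽) x} : ζ ∈ grouplikes 𝔽 n (E.cc 𝔽) x ↔
    ∃ y : E.proj ⁻¹' {x}, locMk 𝔽 n (E.cc 𝔽) x (point 𝔽 (y : E)) = ζ := by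
  have hpt : ∀ y : E.proj ⁻¹' {x}, locMk 𝔽 n (E.cc 𝔽) x (point 𝔽 (y : E)) ∈ grouplikes 𝔽 n (E.cc 𝔽) x := by
    rintro ⟨y, rfl⟩
    exact LocalUnit.mem_grouplikes _
  refine ⟨fun h => ?_, fun ⟨y, hy⟩ => hy ▸ hpt y⟩
  let b := Module.Basis.mk (linearIndependent_point (𝔽 := 𝔽) (E := E) x) (span_point x).ge
  have hb : ∀ y, b y = locMk 𝔽 n (E.cc 𝔽) x (point 𝔽 (y : E)) := fun y => Module.Basis.mk_apply _ _ y
  -- The induced comultiplication and counit are given as linear over `Plus (Cc 𝔽 n M)`. Every germ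
  -- at `x` comes from this ring, so they are also linear over the ring of germs.
  have hs : Function.Surjective (algebraMap (Plus (Cc 𝔽 n M)) (germRing 𝔽 n x)) := toGerm_surjective x
  obtain ⟨y, hy⟩ := grouplike_mem_range_basis germRing_idempotent b
    ((locComul 𝔽 n (E.cc 𝔽) x).extendScalarsOfSurjective hs) (fun y => by rw [hb]; exact (hpt y).1)
    ((locCounit 𝔽 n (E.cc 𝔽) x).extendScalarsOfSurjective hs) h.1 h.2
  exact ⟨y, (hb y).symm.trans hy⟩

theorem freelyGenerated (x : M) : FreelyGenerated 𝔽 n (E.cc 𝔽) x := by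
  have hr : grouplikes 𝔽 n (E.cc 𝔽) x =
      Set.range fun y : E.proj ⁻¹' {x} => locMk 𝔽 n (E.cc 𝔽) x (point 𝔽 (y : E)) :=
    Set.ext fun ζ => mem_grouplikes_iff_exists_point
  refine ⟨?_, hr ▸ span_point x⟩
  -- The independent family is indexed by the fibre; this passes to its range as a set, which is the
  -- set of grouplike elements.
  have := (linearIndependent_point (𝔽 := 𝔽) (E := E) x).linearIndepOn_id
  rw [← hr] at this
  exact this

/-- For different points of one fibre, the two sections have germs 1 and 0 at `y`, whereas elements
of `N_x` have germ zero there. -/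
theorem eq_of_point_sub_mem_Nx {y z : E} (hyz : E.proj z = E.proj y)
    (h : point 𝔽 y - point 𝔽 z ∈ Nx 𝔽 n (E.cc 𝔽) (E.proj y)) : y = z := by
  by_contra hne
  have h1 := Sec.eq_zero_of_mem_Nx E.continuous_proj (Nx_map (E.cc 𝔽).subtype h)
  have h2 : ((point 𝔽 y : E.cc 𝔽) : Sec 𝔽 E.proj) y = (point 𝔽 z : E.cc 𝔽).1 y := sub_eq_zero.1 h1
  rw [show ((point 𝔽 y : E.cc 𝔽) : Sec 𝔽 E.proj) y = 1 from LocalUnit.sec_self _,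
    show ((point 𝔽 z : E.cc 𝔽) : Sec 𝔽 E.proj) y = 0 from LocalUnit.sec_ne _ hyz.symm hne] at h2
  exact one_ne_zero h2

/-- The sections `point 𝔽 z` are chosen independently of each other, but the one chosen at `y` is
also a local unit at every nearby `z`, and any two local units at `z` agree in the stalk. This gives
the continuity of the comparison map. -/
theorem eventually_locMk_point_eq (y : E) : ∀ᶠ z in 𝓝 y,
    locMk 𝔽 n (E.cc 𝔽) (E.proj z) (point 𝔽 z) = locMk 𝔽 n (E.cc 𝔽) (E.proj z) (point 𝔽 y) := by
  let s := Classical.arbitrary (LocalUnit 𝔽 y)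
  filter_upwards [s.elementary.1.mem_nhds s.mem,
    E.continuous_proj.continuousAt.eventually (Cc.germ_eq_one.1 s.germ_eq).eventuallyEq_nhds] with z hz hz'
  -- The same elementary set and function serve at `z`, which lies in that set and over the region
  -- where the function is 1.
  let t : LocalUnit 𝔽 z := ⟨s.U, s.elementary, hz, s.h, s.supp, Cc.germ_eq_one.2 hz'⟩
  have ht : Cc.germ (E.proj z) s.h = 1 := t.germ_eq
  let r := Classical.arbitrary (LocalUnit 𝔽 z)
  obtain ⟨k, hk, e⟩ := exists_star_mk_eq s.elementary s.h s.supp hz r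
  refine ((locMk_eq_iff.2 ⟨k, hk, ?_⟩ : locMk 𝔽 n (E.cc 𝔽) (E.proj z) s.sec = _).trans
    (?_ : locMk 𝔽 n (E.cc 𝔽) (E.proj z) (s.h ⋆ r.sec) = locMk 𝔽 n (E.cc 𝔽) (E.proj z) r.sec)).symm
  · rw [smul_sub, sub_eq_zero]; exact e
  · rw [← germ_smul, ht, one_smul]

end ManifoldSheaf

/-! ### Recovering the sheaf from its coalgebra -/

variable {C : Type v} [AddCommGroup C] [Module (Plus (Cc 𝔽 n M)) C] [NUCoalgebra (Cc 𝔽 n M) C]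

/-- The map from `E` to the spectral sheaf of a coalgebra isomorphic to the sheaf coalgebra of `E`. -/
def toSpectral {E : ManifoldSheaf.{u, w} n M} {β : E.cc 𝔽 →ₗ[Plus (Cc 𝔽 n M)] C} (hβ : IsCoalgHom β) (y : E) :
    spectral 𝔽 n M C :=
  (⟨E.proj y, locMk 𝔽 n C (E.proj y) (β (ManifoldSheaf.point 𝔽 y)),
    mk_mem_grouplikes (hβ.weaklyGrouplike (ManifoldSheaf.LocalUnit.sec_mem_weaklyGrouplike _))
      (hβ.normalized.2 (ManifoldSheaf.LocalUnit.normalized _))⟩ : SpecPt 𝔽 n M C)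

/-- If `y` is mapped into `c_W`, then near `y` the class of the image of `point 𝔽 z` is that of the
image of the fixed section `point 𝔽 y`, which in turn coincides with the class of `c` at nearby base
points. -/
theorem continuous_toSpectral {E : ManifoldSheaf.{u, w} n M} {β : E.cc 𝔽 →ₗ[Plus (Cc 𝔽 n M)] C}
    (hβ : IsCoalgHom β) : Continuous (toSpectral hβ) := by
  refine continuous_generateFrom_iff.2 ?_
  rintro _ ⟨c, W, h, rfl⟩
  refine isOpen_iff_mem_nhds.2 fun y hy => ?_
  have h1 : locMk 𝔽 n C (E.proj y) (β (ManifoldSheaf.point 𝔽 y)) = locMk 𝔽 n C (E.proj y) c := hy.2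
  filter_upwards [E.continuous_proj.continuousAt.eventually (eventually_locMk_eq h1),
    E.continuous_proj.continuousAt.eventually (h.isOpen.mem_nhds hy.1),
    ManifoldSheaf.eventually_locMk_point_eq (𝔽 := 𝔽) y] with z hz hzW hz'
  refine ⟨hzW, Eq.trans ?_ hz⟩
  rw [locMk_eq_iff] at hz'
  exact locMk_eq_iff.2 (map_sub β _ _ ▸ Nx_map β hz')

/-- Applying the isomorphism `α` brings the question into the sheaf coalgebra. There, distinct
points of a fibre have distinct classes, which gives injectivity, and every grouplike element comes
from a point, which gives surjectivity. -/
theorem isomorphic_spectral {E : ManifoldSheaf.{u, w} n M} (h : CoalgIsomorphic (Cc 𝔽 n M) C (E.cc 𝔽)) :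
    E.Isomorphic (spectral 𝔽 n M C) := by
  obtain ⟨α, hα⟩ := h
  refine isomorphic_of_bijective (continuous_toSpectral hα.symm) ⟨fun y z e => ?_, fun p => ?_⟩ fun _ => rfl
  · have h1 : E.proj y = E.proj z := congrArg SpecPt.pt e
    refine ManifoldSheaf.eq_of_point_sub_mem_Nx (𝔽 := 𝔽) h1.symm ?_
    -- The germs of equal points lie in stalks that are only propositionally equal, so the
    -- comparison is made for general `p = q`, where the equality can be eliminated.
    have h2 : ∀ p q : SpecPt 𝔽 n M C, p = q → ∀ c d : C, p.germ = locMk 𝔽 n C p.pt c →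
        q.germ = locMk 𝔽 n C q.pt d → c - d ∈ Nx 𝔽 n C p.pt := by
      rintro p _ rfl c d hc hd
      exact locMk_eq_iff.1 (hc.symm.trans hd)
    have h3 : _ ∈ Nx 𝔽 n (E.cc 𝔽) (E.proj y) := Nx_map α.toLinearMap (h2 _ _ e _ _ rfl rfl)
    simpa using h3
  · obtain ⟨x, ζ, hζ⟩ := p
    obtain ⟨c, hc, hx, rfl⟩ := mem_grouplikes_iff.1 hζ
    obtain ⟨⟨y, rfl⟩, hy⟩ := ManifoldSheaf.mem_grouplikes_iff_exists_point.1
      (mk_mem_grouplikes (hα.weaklyGrouplike hc) (hα.normalized.2 hx))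
    refine ⟨y, SpecPt.eq_of_eq (c := c) rfl (locMk_eq_iff.2 ?_) rfl⟩
    have := Nx_map α.symm.toLinearMap (locMk_eq_iff.1 hy)
    simpa using this

end
end SheafCoalg

/-! ### The equivalence of the four conditions -/

theorem theorem14 (𝔽 : Type) [RCLike 𝔽] (n : ℕ) (M : Type u) [TopologicalSpace M] [T2Space M]
    [ChartedSpace (EuclideanSpace ℝ (Fin n)) M] [IsManifold (𝓡 n) ∞ M]
    (C : Type v) [AddCommGroup C] [Module (Plus (Cc 𝔽 n M)) C] [NUCoalgebra (Cc 𝔽 n M) C] :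
    List.TFAE [
      ∃ E : ManifoldSheaf.{u, max u v} n M, CoalgIsomorphic (Cc 𝔽 n M) C (E.cc 𝔽),
      Function.Bijective (Psi 𝔽 n M C),
      NormallyGenerates 𝔽 n M (weaklyGrouplike 𝔽 n M C) ∧
        NormallyLinearIndependent 𝔽 n M (weaklyGrouplike 𝔽 n M C),
      ∀ x : M, FreelyGenerated 𝔽 n C x] ∧
    ∀ E : ManifoldSheaf.{u, w} n M, CoalgIsomorphic (Cc 𝔽 n M) C (E.cc 𝔽) →
      E.Isomorphic (spectral 𝔽 n M C) := by
  refine ⟨?_, fun E => isomorphic_spectral⟩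
  tfae_have 3 ↔ 4 := normal_iff_freelyGenerated
  tfae_have 1 → 3 := fun ⟨E, h⟩ => by
    have hE := normal_iff_freelyGenerated.2 (ManifoldSheaf.freelyGenerated (𝔽 := 𝔽) (E := E))
    exact ⟨hE.1.of_isomorphic h.symm, hE.2.of_isomorphic h⟩
  tfae_have 3 → 2 := fun h =>
    ⟨Psi_injective (normallyLinearIndependent_iff.1 h.2), Psi_surjective h.1⟩
  tfae_have 2 → 1 := fun h =>
    ⟨spectral 𝔽 n M C, CoalgIsomorphic.symm ⟨LinearEquiv.ofBijective (Psi 𝔽 n M C) h, Psi_isCoalgHom⟩⟩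
  tfae_finish
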